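/- Let $p(x)=\dfrac{\cosh(x-[x]-\frac12)}{2\sinh\frac12}$, $x\in\mathbb R$, where $[x]$ is the integer part of $x$. For real $\alpha,\beta$ put $$I(\alpha,\beta)=\inf\Bigl\{\int_0^1 (p+\beta p_x)(\alpha u^2+u_x^2)\,dx:\ u\in H^1(0,1),\ u(0)=u(1)=1\Bigr\}\in[-\infty,\infty),$$ and for $\gamma\in\mathbb R\setminus\{0\}$ put $$\beta_\gamma=\inf\Bigl\{\beta\ge 0:\ \beta^2+I\bigl(\tfrac{3-\gamma}{\gamma},\beta\bigr)-\tfrac{3-\gamma}{\gamma}\ge 0\Bigr\}\in[0,\infty],\qquad \inf\emptyset=+\infty.$$ **Constants.** The sets $\{\alpha\in\mathbb R: (\frac{e+1}{e-1})^2+I(\alpha,\frac{e+1}{e-1})-\alpha\ge0\}$ and $\{\alpha\in\mathbb R: 1+I(\alpha,1)-\alpha\ge 0\}$ are compact intervals $[\alpha_1^-,\alpha_1^+]$ and $[\alpha_2^-,\alpha_2^+]$ respectively, and the constants $\gamma_i^\pm=\dfrac{3}{1+\alpha_i^\pm}$ satisfy $$\gamma_1^-=-1.036\ldots,\quad \gamma_1^+=0.269\ldots,\quad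 \gamma_2^-=-1.508\ldots,\quad \gamma_2^+=0.575\ldots$$ **Notation.** For $\gamma\neq0$ let $\mu\in\mathbb C$ be $\mu=\frac12\sqrt{1+4(3-\gamma)/\gamma}$, with any of the two complex square roots, and let $$M=\mu\cdot\frac{\cosh\frac12\cosh\mu-1}{\sinh\frac12\sinh\mu},\qquad L=\frac{(e+1)^2}{2e}\cdot\frac{P'_{-1/2+\mu}(\cosh 1)}{P_{-1/2+\mu}(\cosh 1)},$$ where $M$ is given its limit value $\frac{\cosh\frac12-1}{\sinh\frac12}$ when $\mu=0$, and $P_\nu(z)={}_2F_1(-\nu,\nu+1;1;\frac{1-z}{2})$ is the Legendre function of the first kind of degree $\nu$. **Theorem 2.2.** (i) For every $\gamma\in(-\infty,\gamma_1^-]\cup[\gamma_1^+,\infty)$ one has $\beta_\gamma<\infty$. More precisely: - If $\gamma\in(-\infty,\gamma_2^-]\cup[\gamma_2^+,\infty)$, then $\frac3\gamma-\frac12-M$ is a nonnegative real number and $$\beta_\gamma\le\sqrt{\frac3\gamma-\frac12-M}.$$ - If $\gamma\in[\gamma_2^-,\gamma_1^-]\cup[\gamma_1^+,\gamma_2^+]$,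 then $P_{-1/2+\mu}(\cosh1)\ne0$, the numbers $$b=\frac{e-1}{2}\Bigl(L+\frac12-M\Bigr),\qquad c=\frac{e+1}{2}\Bigl(-\frac12+M\Bigr)-\frac{e-1}{2}L-\frac{3-\gamma}{\gamma}$$ are real, $b^2-4c\ge0$, and $$\beta_\gamma\le-\frac b2+\frac12\sqrt{b^2-4c}.$$ (ii) The limits of $\beta_\gamma$ as $\gamma\to+\infty$ and as $\gamma\to-\infty$ exist and are equal to one and the same finite number $\beta_\infty$, and $$\beta_\infty\le\sqrt{\frac{\sqrt3\,\bigl(1-\cosh\frac12\cos\frac{\sqrt3}{2}\bigr)}{2\sinh\frac12\sin\frac{\sqrt3}{2}}-\frac12}=0.296\ldots$$ -/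

import Mathlib

open MeasureTheory Filter Topology
open scoped ContDiff NNReal ENNReal

namespace Rod

noncomputable section

/-- The continuous `1`-periodic kernel `p` of `(1 - ∂ₓ²)⁻¹` on the circle `ℝ / ℤ`. -/
def kernel (x : ℝ) : ℝ :=
  Real.cosh (x - (⌊x⌋ : ℝ) - 1 / 2) / (2 * Real.sinh (1 / 2))

/-- `g` is the distributional derivative of `u` on the open interval `(0,1)`. -/
def HasWeakDeriv (u g : ℝ → ℝ) : Prop :=
  ∀ φ : ℝ → ℝ, ContDiff ℝ ∞ φ → HasCompactSupport φ → tsupport φ ⊆ Set.Ioo 0 1 →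
    ∫ x in (0 : ℝ)..1, u x * deriv φ x = -∫ x in (0 : ℝ)..1, g x * φ x

/-- `u` belongs to `H¹(0,1)` and has weak derivative `g`; as usual `u` stands for its
continuous representative on `[0,1]`, so that the boundary values `u 0`, `u 1` make sense. -/
structure IsH1 (u g : ℝ → ℝ) : Prop where
  continuousOn : ContinuousOn u (Set.Icc 0 1)
  memLp : MemLp u 2 (volume.restrict (Set.Ioo 0 1))
  memLp_deriv : MemLp g 2 (volume.restrict (Set.Ioo 0 1))
  hasWeakDeriv : HasWeakDeriv u g

/-- The functional `∫₀¹ (p + β pₓ) (α u² + uₓ²) dx`, where `g` is the weak derivative of `u`. -/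
def energy (α β : ℝ) (u g : ℝ → ℝ) : ℝ :=
  ∫ x in (0 : ℝ)..1, (kernel x + β * deriv kernel x) * (α * u x ^ 2 + g x ^ 2)

/-- `I(α,β) ∈ [-∞, ∞)`: the infimum of the functional over all `u ∈ H¹(0,1)` with
`u(0) = u(1) = 1`. -/
def minEnergy (α β : ℝ) : EReal :=
  sInf {t : EReal | ∃ u g : ℝ → ℝ, IsH1 u g ∧ u 0 = 1 ∧ u 1 = 1 ∧ t = (energy α β u g : ℝ)}

/-- `β² + I(α,β) - α`. -/
def gap (α β : ℝ) : EReal :=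
  ((β ^ 2 : ℝ) : EReal) + minEnergy α β - (α : EReal)

/-- `α = (3 - γ) / γ`. -/
def alphaOf (γ : ℝ) : ℝ := (3 - γ) / γ

/-- `β_γ = inf {β ≥ 0 : β² + I((3-γ)/γ, β) - (3-γ)/γ ≥ 0} ∈ [0, ∞]`, with `inf ∅ = ∞`. -/
def betaGamma (γ : ℝ) : ℝ≥0∞ :=
  sInf {b : ℝ≥0∞ | ∃ β : ℝ≥0, 0 ≤ gap (alphaOf γ) (β : ℝ) ∧ b = (β : ℝ≥0∞)}

/-- The endpoint value `(e + 1) / (e - 1)`. -/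
def kappa : ℝ := (Real.exp 1 + 1) / (Real.exp 1 - 1)

/-- The set of all real `α` with `β² + I(α,β) - α ≥ 0`. -/
def admissible (β : ℝ) : Set ℝ := {α : ℝ | 0 ≤ gap α β}

def alphaMinus (β : ℝ) : ℝ := sInf (admissible β)

def alphaPlus (β : ℝ) : ℝ := sSup (admissible β)

def gammaOneMinus : ℝ := 3 / (1 + alphaMinus kappa)

def gammaOnePlus : ℝ := 3 / (1 + alphaPlus kappa)

def gammaTwoMinus : ℝ := 3 / (1 + alphaMinus 1)

def gammaTwoPlus : ℝ := 3 / (1 + alphaPlus 1)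

/-- `μ (cosh ½ cosh μ - 1) / (sinh ½ sinh μ)`, with its limit as value at the removable
singularity `μ = 0`. -/
def hypTerm (μ : ℂ) : ℂ :=
  if μ = 0 then (Complex.cosh (1 / 2) - 1) / Complex.sinh (1 / 2)
  else μ * ((Complex.cosh (1 / 2) * Complex.cosh μ - 1) / (Complex.sinh (1 / 2) * Complex.sinh μ))

/-- The Legendre function of the first kind `P_ν(z) = ₂F₁(-ν, ν + 1; 1; (1 - z) / 2)`, given by
its hypergeometric series, which converges for `|1 - z| < 2`; only the point `z = cosh 1`
is used. -/
def legendreP (ν z : ℂ) : ℂ :=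
  ordinaryHypergeometric (-ν) (ν + 1) (1 : ℂ) ((1 - z) / 2)

/-- `((e + 1)² / (2 e)) P_ν'(cosh 1) / P_ν(cosh 1)` for `ν = -1/2 + μ`. -/
def legTerm (μ : ℂ) : ℂ :=
  ((Real.exp 1 + 1) ^ 2 / (2 * Real.exp 1) : ℝ) *
    (deriv (legendreP (-1 / 2 + μ)) (Complex.cosh 1) / legendreP (-1 / 2 + μ) (Complex.cosh 1))

end

end Rod

/-! On `(0,1)` the weight `p + β pₓ` is affine in `β`, so the functional is affine in `α` for fixed
`β` and in `β` for fixed `α`. Its infimum `I` is therefore concave in each variable separately, and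
exact values of `I` at a few `β` give lower bounds between them.

Exact values come from completing the square. If `r` solves the Riccati equation with flux `q = w
r`, `q' = w (α - r²)`, where `w` is the weight, then the energy is `[q u²]₀¹ + ∫ w (u' - r u)²`. For
`w ≥ 0` this bounds the energy below by `q 1 - q 0`, and the bound is sharp when `u' = r u` has a
solution with the right boundary values. At `β = 1` the weight is exponential and the Euler-Lagrange
equation has constant coefficients, so `I(α,1)` is the elementary `minOne α`; reflection `x ↦ 1 - x`
gives the same lower bound at `β = -1`. At `β = κ = coth ½` the weight is a multiple of `sinh x` and
the equation is Legendre's. The weight vanishes at `0`, so that point has zero capacity, the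
boundary condition there is free, and the regular solution gives `I(α,κ) = minKappa α`.

Concavity on `[-1,1]` gives `I(α,β) ≥ minOne α`, and `β² = α - minOne α` is the square-root bound.
Concavity on `[1,κ]` gives the chord through `minOne α` and `minKappa α`; adding `β² - α` yields the
quadratic `β² + bβ + c`, which changes sign on `[1,κ]` exactly because the gap is `≤ 0` at `1` and
`≥ 0` at `κ`. The constants are located by testing points on either side of each endpoint of the two
`α`-intervals, with truncated series.

For the limits, `γ → ±∞` means `α → -1` from either side, so it suffices that the optimal `β` is
continuous in `α` at `-1`. Lower bounds for `I` are Lipschitz in `α` there, and moving an admissible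
`β` a little towards `1` gains a definite amount in the gap; `exists_near_admissible` combines the
two facts. -/

namespace Rod

noncomputable section

/-! ### The weight in closed form -/

/-- The weight `p + β pₓ` on `(0,1)`, written without integer parts. -/
def weight (β x : ℝ) : ℝ :=
  (Real.cosh (x - 1 / 2) + β * Real.sinh (x - 1 / 2)) / (2 * Real.sinh (1 / 2))

lemma kernel_eq {x : ℝ} (hx : x ∈ Set.Ioo (0 : ℝ) 1) :
    kernel x = Real.cosh (x - 1 / 2) / (2 * Real.sinh (1 / 2)) := by
  have : ⌊x⌋ = 0 := by
    rw [Int.floor_eq_iff]; simp only [Int.cast_zero, zero_add]; exact ⟨hx.1.le, hx.2⟩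
  simp [kernel, this]

lemma deriv_kernel_eq {x : ℝ} (hx : x ∈ Set.Ioo (0 : ℝ) 1) :
    deriv kernel x = Real.sinh (x - 1 / 2) / (2 * Real.sinh (1 / 2)) := by
  have h : kernel =ᶠ[𝓝 x] fun y => Real.cosh (y - 1 / 2) / (2 * Real.sinh (1 / 2)) := by
    filter_upwards [isOpen_Ioo.mem_nhds hx] with y hy using kernel_eq hy
  rw [h.deriv_eq]
  have h2 : HasDerivAt (fun y : ℝ => Real.cosh (y - 1 / 2) / (2 * Real.sinh (1 / 2)))
      (Real.sinh (x - 1 / 2) * 1 / (2 * Real.sinh (1 / 2))) x :=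
    ((((hasDerivAt_id x).sub_const (1 / 2)).cosh).div_const _)
  rw [h2.deriv, mul_one]

lemma weight_eq (β : ℝ) {x : ℝ} (hx : x ∈ Set.Ioo (0 : ℝ) 1) :
    kernel x + β * deriv kernel x = weight β x := by
  rw [kernel_eq hx, deriv_kernel_eq hx, weight]; ring

lemma integral_congr_Ioo {f g : ℝ → ℝ} (h : ∀ x ∈ Set.Ioo (0 : ℝ) 1, f x = g x) :
    ∫ x in (0 : ℝ)..1, f x = ∫ x in (0 : ℝ)..1, g x := by
  rw [intervalIntegral.integral_of_le zero_le_one, intervalIntegral.integral_of_le zero_le_one,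
    integral_Ioc_eq_integral_Ioo, integral_Ioc_eq_integral_Ioo]
  exact setIntegral_congr_fun measurableSet_Ioo h

lemma energy_eq (α β : ℝ) (u g : ℝ → ℝ) :
    energy α β u g = ∫ x in (0 : ℝ)..1, weight β x * (α * u x ^ 2 + g x ^ 2) :=
  integral_congr_Ioo fun x hx => by rw [weight_eq β hx]

lemma continuous_weight (β : ℝ) : Continuous (weight β) := by
  unfold weight; fun_prop

/-! ### Weak derivatives and absolute continuity -/

lemma exists_Icc_of_isCompact_subset_Ioo {K : Set ℝ} (hK : IsCompact K)
    (hsub : K ⊆ Set.Ioo (0 : ℝ) 1) : ∃ a b : ℝ, 0 < a ∧ a < b ∧ b < 1 ∧ K ⊆ Set.Icc a b := by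
  rcases K.eq_empty_or_nonempty with rfl | hne
  · exact ⟨1 / 3, 1 / 2, by norm_num, by norm_num, by norm_num, Set.empty_subset _⟩
  obtain ⟨a, ha, ha'⟩ := hK.exists_isLeast hne
  obtain ⟨b, hb, hb'⟩ := hK.exists_isGreatest hne
  have h1 := hsub ha
  have h2 := hsub hb
  -- Halving the minimum keeps the interval nondegenerate when `K` is a single point.
  refine ⟨a / 2, b, half_pos h1.1, ?_, h2.2, fun x hx => ⟨?_, hb' hx⟩⟩
  · linarith [ha' hb, h1.1]
  · linarith [ha' hx, h1.1]

/-- A smooth function with compact support in `(0,1)` and vanishing integral is the derivative of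
such a function. -/
lemma exists_primitive_of_integral_eq_zero {θ : ℝ → ℝ} (hθ : ContDiff ℝ ∞ θ)
    (hc : HasCompactSupport θ) (hs : tsupport θ ⊆ Set.Ioo 0 1)
    (h0 : ∫ x in (0 : ℝ)..1, θ x = 0) :
    ∃ φ : ℝ → ℝ, ContDiff ℝ ∞ φ ∧ HasCompactSupport φ ∧ tsupport φ ⊆ Set.Ioo 0 1 ∧
      deriv φ = θ := by
  obtain ⟨a, b, ha, hab, hb, hK⟩ := exists_Icc_of_isCompact_subset_Ioo hc hs
  have hz : ∀ x, x ∉ Set.Icc a b → θ x = 0 := fun x hx => by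
    by_contra h
    exact hx (hK (subset_tsupport _ h))
  have hcont : Continuous θ := hθ.continuous
  set φ : ℝ → ℝ := fun x => ∫ t in (0 : ℝ)..x, θ t with hφ
  have hd : ∀ x, HasDerivAt φ (θ x) x := fun x =>
    intervalIntegral.integral_hasDerivAt_right (hcont.intervalIntegrable _ _)
      (hcont.stronglyMeasurableAtFilter _ _) hcont.continuousAt
  have hder : deriv φ = θ := funext fun x => (hd x).deriv
  have hsupp : Function.support φ ⊆ Set.Icc a b := by
    intro x hx
    by_contra hx'
    apply hx
    rw [Set.mem_Icc, not_and_or, not_le, not_le] at hx'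
    rcases hx' with h | h
    · have : ∫ t in (0 : ℝ)..x, θ t = ∫ t in (0 : ℝ)..x, (0 : ℝ) := by
        apply intervalIntegral.integral_congr
        intro t ht
        apply hz
        intro ht'
        rcases Set.mem_uIcc.1 ht with h' | h' <;> linarith [ht'.1, h'.1, h'.2]
      simpa [hφ] using this
    · have : ∫ t in x..1, θ t = ∫ t in x..1, (0 : ℝ) := by
        apply intervalIntegral.integral_congr
        intro t ht
        apply hz
        intro ht'
        rcases Set.mem_uIcc.1 ht with h' | h' <;> linarith [ht'.2, h'.1, h'.2]
      have h2 := intervalIntegral.integral_add_adjacent_intervals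
        (hcont.intervalIntegrable 0 x (μ := volume)) (hcont.intervalIntegrable x 1)
      rw [this, h0] at h2
      simpa [hφ] using h2
  have hts : tsupport φ ⊆ Set.Icc a b := closure_minimal hsupp isClosed_Icc
  refine ⟨φ, ?_, ?_, hts.trans fun x hx => ⟨ha.trans_le hx.1, hx.2.trans_lt hb⟩, hder⟩
  · rw [contDiff_infty_iff_deriv]
    exact ⟨fun x => (hd x).differentiableAt, hder ▸ hθ⟩
  · exact HasCompactSupport.intro isCompact_Icc fun x hx => by
      by_contra h
      exact hx (hsupp h)

/-- The lemma of du Bois-Reymond on `(0,1)`. -/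
lemma eqOn_const_of_integral_mul_deriv_eq_zero {f : ℝ → ℝ}
    (hf : ContinuousOn f (Set.Icc 0 1))
    (h : ∀ φ : ℝ → ℝ, ContDiff ℝ ∞ φ → HasCompactSupport φ → tsupport φ ⊆ Set.Ioo 0 1 →
      ∫ x in (0 : ℝ)..1, f x * deriv φ x = 0) :
    ∀ x ∈ Set.Icc (0 : ℝ) 1, f x = f 0 := by
  let ψ₀ : ContDiffBump (1 / 2 : ℝ) := ⟨1 / 8, 1 / 4, by norm_num, by norm_num⟩
  set ψ : ℝ → ℝ := ψ₀.normed volume with hψ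
  have ψs : tsupport ψ ⊆ Set.Ioo 0 1 := by
    rw [hψ, ContDiffBump.tsupport_normed_eq]
    intro x hx
    rw [Metric.mem_closedBall, Real.dist_eq, abs_le] at hx
    have : ψ₀.rOut = 1 / 4 := rfl
    constructor <;> linarith [hx.1, hx.2]
  have ψd : ContDiff ℝ ∞ ψ := ψ₀.contDiff_normed
  have ψc : HasCompactSupport ψ := ψ₀.hasCompactSupport_normed
  have supp : ∀ {η : ℝ → ℝ}, tsupport η ⊆ Set.Ioo 0 1 → ∀ k : ℝ → ℝ,
      ∫ x in (0 : ℝ)..1, η x * k x = ∫ x, η x * k x := by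
    intro η hη k
    apply intervalIntegral.integral_eq_integral_of_support_subset
    intro x hx
    have : η x ≠ 0 := fun h0 => hx (by simp [h0])
    exact Set.Ioo_subset_Ioc_self (hη (subset_tsupport _ this))
  have ψi : ∫ x in (0 : ℝ)..1, ψ x = 1 := by
    have := supp ψs (fun _ => 1)
    simp only [mul_one] at this
    rw [this]
    exact ψ₀.integral_normed
  have hfi : ∀ η : ℝ → ℝ, Continuous η →
      IntervalIntegrable (fun x => f x * η x) volume 0 1 := fun η hη => by
    apply ContinuousOn.intervalIntegrable
    rw [Set.uIcc_of_le zero_le_one]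
    exact hf.mul hη.continuousOn
  set c : ℝ := ∫ x in (0 : ℝ)..1, f x * ψ x with hc
  have key : ∀ η : ℝ → ℝ, ContDiff ℝ ∞ η → HasCompactSupport η → tsupport η ⊆ Set.Ioo 0 1 →
      ∫ x, η x • (f x - c) = 0 := by
    intro η ηd ηc ηs
    set I : ℝ := ∫ x in (0 : ℝ)..1, η x with hI
    -- Subtracting `I ψ`, with `ψ` a bump of mass one, makes the mean of `η` vanish, so the
    -- difference is a derivative of a test function and the hypothesis applies.
    obtain ⟨φ, φd, φc, φs, hφ⟩ := exists_primitive_of_integral_eq_zero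
      (θ := fun x => η x - I * ψ x) (ηd.sub (contDiff_const.mul ψd))
      (HasCompactSupport.sub ηc (ψc.mul_left (f := fun _ => I)))
      ((tsupport_sub _ _).trans (Set.union_subset ηs
        ((tsupport_mul_subset_right (f := fun _ => I)).trans ψs)))
      (by
        rw [intervalIntegral.integral_sub (ηd.continuous.intervalIntegrable _ _)
          ((ψd.continuous.intervalIntegrable _ _).const_mul I),
          intervalIntegral.integral_const_mul, ψi]
        simp [hI])
    have h1 := h φ φd φc φs
    rw [hφ] at h1
    simp only [smul_eq_mul]
    rw [← supp ηs]
    have h2 : ∀ x, f x * (η x - I * ψ x) = f x * η x - I * (f x * ψ x) := fun x => by ring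
    simp only [h2] at h1
    rw [intervalIntegral.integral_sub (hfi _ ηd.continuous)
      ((hfi _ ψd.continuous).const_mul I), intervalIntegral.integral_const_mul, ← hc] at h1
    have h3 : ∀ x, η x * (f x - c) = f x * η x - c * η x := fun x => by ring
    simp only [h3]
    rw [intervalIntegral.integral_sub (hfi _ ηd.continuous)
      ((ηd.continuous.intervalIntegrable _ _).const_mul c), intervalIntegral.integral_const_mul,
      ← hI]
    linarith
  have hae := isOpen_Ioo.ae_eq_zero_of_integral_contDiff_smul_eq_zero (μ := volume)
    (f := fun x => f x - c) (U := Set.Ioo (0 : ℝ) 1)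
    (((hf.mono Set.Ioo_subset_Icc_self).sub continuousOn_const).locallyIntegrableOn
      measurableSet_Ioo) key
  have hIoo : ∀ x ∈ Set.Ioo (0 : ℝ) 1, f x = c := by
    have h1 : (fun x => f x - c) =ᵐ[volume.restrict (Set.Ioo (0 : ℝ) 1)] fun _ => 0 :=
      (ae_restrict_iff' measurableSet_Ioo).2 hae
    have h2 := Measure.eqOn_open_of_ae_eq h1 isOpen_Ioo
      ((hf.mono Set.Ioo_subset_Icc_self).sub continuousOn_const) continuousOn_const
    intro x hx
    have := h2 hx
    simp only at this
    linarith
  have hIcc : Set.EqOn f (fun _ => c) (Set.Icc 0 1) := by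
    have h3 : Set.EqOn f (fun _ => c) (Set.Ioo 0 1) := hIoo
    refine h3.of_subset_closure hf continuousOn_const Set.Ioo_subset_Icc_self ?_
    rw [closure_Ioo zero_ne_one]
  intro x hx
  rw [hIcc hx, hIcc (Set.left_mem_Icc.2 zero_le_one)]

namespace IsH1

variable {u g : ℝ → ℝ}

lemma intervalIntegrable_sq (h : IsH1 u g) :
    IntervalIntegrable (fun x => g x ^ 2) volume 0 1 := by
  rw [intervalIntegrable_iff_integrableOn_Ioo_of_le zero_le_one]
  exact h.memLp_deriv.integrable_sq

lemma intervalIntegrable (h : IsH1 u g) : IntervalIntegrable g volume 0 1 := by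
  rw [intervalIntegrable_iff_integrableOn_Ioo_of_le zero_le_one]
  exact h.memLp_deriv.integrable (by norm_num)

/-- The primitive of `g` has the same weak derivative as `u`, so their difference is constant by du
Bois-Reymond. This makes `u` absolutely continuous, as integration by parts requires. -/
lemma eq_add_integral (h : IsH1 u g) :
    ∀ x ∈ Set.Icc (0 : ℝ) 1, u x = u 0 + ∫ t in (0 : ℝ)..x, g t := by
  set G : ℝ → ℝ := fun x => ∫ t in (0 : ℝ)..x, g t with hG
  have hGac : AbsolutelyContinuousOnInterval G 0 1 :=
    h.intervalIntegrable.absolutelyContinuousOnInterval_intervalIntegral (by simp)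
  have hGc : ContinuousOn G (Set.Icc 0 1) := by
    have := hGac.continuousOn
    rwa [Set.uIcc_of_le zero_le_one] at this
  have hmain := eqOn_const_of_integral_mul_deriv_eq_zero (f := fun x => u x - G x)
    (h.continuousOn.sub hGc) (by
      intro φ φd φc φs
      have hφ0 : φ 0 = 0 := by
        by_contra h0; exact absurd (φs (subset_tsupport _ h0)).1 (lt_irrefl _)
      have hφ1 : φ 1 = 0 := by
        by_contra h0; exact absurd (φs (subset_tsupport _ h0)).2 (lt_irrefl _)
      have φac : AbsolutelyContinuousOnInterval φ 0 1 :=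
        (φd.of_le (by exact_mod_cast le_top)).contDiffOn.absolutelyContinuousOnInterval
      have h1 := hGac.integral_mul_deriv_eq_deriv_mul φac
      rw [hφ0, hφ1] at h1
      have h2 : ∫ x in (0 : ℝ)..1, deriv G x * φ x = ∫ x in (0 : ℝ)..1, g x * φ x := by
        apply intervalIntegral.integral_congr_ae
        filter_upwards [h.intervalIntegrable.ae_hasDerivAt_integral] with x hx hx'
        rw [(hx (Set.uIoc_subset_uIcc hx') 0 (by simp)).deriv]
      have h3 := h.hasWeakDeriv φ φd φc φs
      have hφ' : Continuous (deriv φ) := φd.continuous_deriv (by exact_mod_cast le_top)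
      have e : ∀ x, (u x - G x) * deriv φ x = u x * deriv φ x - G x * deriv φ x :=
        fun x => by ring
      simp only [e]
      rw [intervalIntegral.integral_sub, h3, h1, h2]
      · ring
      · apply ContinuousOn.intervalIntegrable
        rw [Set.uIcc_of_le zero_le_one]
        exact h.continuousOn.mul hφ'.continuousOn
      · apply ContinuousOn.intervalIntegrable
        rw [Set.uIcc_of_le zero_le_one]
        exact hGc.mul hφ'.continuousOn)
  intro x hx
  have := hmain x hx
  simp only [hG, intervalIntegral.integral_same] at this
  linarith

/-- The integrand is the a.e. derivative of `q u²`, a product of absolutely continuous functions.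
This null Lagrangian is what completing the square adds to the energy. -/
lemma integral_mul_sq (h : IsH1 u g) {q q' : ℝ → ℝ}
    (hq : ∀ x ∈ Set.Icc (0 : ℝ) 1, HasDerivAt q (q' x) x)
    (hq' : ContinuousOn q' (Set.Icc 0 1)) :
    ∫ x in (0 : ℝ)..1, (q' x * u x ^ 2 + 2 * q x * u x * g x) = q 1 * u 1 ^ 2 - q 0 * u 0 ^ 2 := by
  set G : ℝ → ℝ := fun x => u 0 + ∫ t in (0 : ℝ)..x, g t with hG
  have hu := h.eq_add_integral
  have hGac : AbsolutelyContinuousOnInterval G 0 1 :=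
    (ContDiffOn.absolutelyContinuousOnInterval (f := fun _ => u 0) contDiffOn_const).fun_add
      (h.intervalIntegrable.absolutelyContinuousOnInterval_intervalIntegral (by simp))
  have hqac : AbsolutelyContinuousOnInterval q 0 1 := by
    obtain ⟨C, hC⟩ := isCompact_Icc.exists_bound_of_continuousOn hq'
    have hl : LipschitzOnWith (Real.toNNReal C) q (Set.Icc 0 1) := by
      refine (convex_Icc (0 : ℝ) 1).lipschitzOnWith_of_nnnorm_hasDerivWithin_le
        (fun x hx => (hq x hx).hasDerivWithinAt) fun x hx => ?_
      rw [← NNReal.coe_le_coe, coe_nnnorm]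
      exact (hC x hx).trans (Real.le_coe_toNNReal C)
    rw [← Set.uIcc_of_le (zero_le_one' ℝ)] at hl
    exact hl.absolutelyContinuousOnInterval
  have h1 := hqac.integral_deriv_mul_eq_sub (hGac.fun_mul hGac)
  have h0 : G 0 = u 0 := by simp [hG]
  have h11 : G 1 = u 1 := (hu 1 (by simp)).symm
  simp only [h0, h11] at h1
  rw [pow_two, pow_two, ← h1]
  apply intervalIntegral.integral_congr_ae
  filter_upwards [h.intervalIntegrable.ae_hasDerivAt_integral] with x hx hx'
  have hxI : x ∈ Set.Icc (0 : ℝ) 1 := by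
    have := Set.uIoc_subset_uIcc hx'
    rwa [Set.uIcc_of_le zero_le_one] at this
  have hd : HasDerivAt G (g x) x := (hx (Set.uIoc_subset_uIcc hx') 0 (by simp)).const_add _
  rw [(hq x hxI).deriv, (hd.fun_mul hd).deriv, hu x hxI]
  simp only [hG]
  ring

end IsH1

/-- A function that is continuously differentiable near `[0,1]` belongs to `H¹(0,1)`. -/
lemma isH1_of_hasDerivAt {u g : ℝ → ℝ} (hu : ∀ x ∈ Set.Icc (0 : ℝ) 1, HasDerivAt u (g x) x)
    (hg : ContinuousOn g (Set.Icc 0 1)) : IsH1 u g := by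
  have huc : ContinuousOn u (Set.Icc 0 1) := fun x hx => (hu x hx).continuousAt.continuousWithinAt
  have mem : ∀ {f : ℝ → ℝ}, ContinuousOn f (Set.Icc 0 1) →
      MemLp f 2 (volume.restrict (Set.Ioo 0 1)) := by
    intro f hf
    obtain ⟨C, hC⟩ := isCompact_Icc.exists_bound_of_continuousOn hf
    refine MemLp.of_bound ((hf.mono Set.Ioo_subset_Icc_self).aestronglyMeasurable
      measurableSet_Ioo) C ?_
    rw [ae_restrict_iff' measurableSet_Ioo]
    exact Eventually.of_forall fun x hx => hC x (Set.Ioo_subset_Icc_self hx)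
  refine ⟨huc, mem huc, mem hg, fun φ φd _ φs => ?_⟩
  have hφ0 : φ 0 = 0 := by
    by_contra h0; exact absurd (φs (subset_tsupport _ h0)).1 (lt_irrefl _)
  have hφ1 : φ 1 = 0 := by
    by_contra h0; exact absurd (φs (subset_tsupport _ h0)).2 (lt_irrefl _)
  rw [intervalIntegral.integral_mul_deriv_eq_deriv_mul (u' := g)
    (fun x hx => hu x (by rwa [Set.uIcc_of_le zero_le_one] at hx))
    (fun x _ => (φd.differentiable (by simp) x).hasDerivAt)
    (by apply ContinuousOn.intervalIntegrable; rwa [Set.uIcc_of_le zero_le_one])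
    ((φd.continuous_deriv (by exact_mod_cast le_top)).intervalIntegrable _ _), hφ0, hφ1]
  ring

/-! ### The energy: affine dependence and the Riccati identity -/

namespace IsH1

variable {u g : ℝ → ℝ}

lemma intervalIntegrable_mul_sq_left (h : IsH1 u g) {a : ℝ → ℝ}
    (ha : ContinuousOn a (Set.Icc 0 1)) :
    IntervalIntegrable (fun x => a x * u x ^ 2) volume 0 1 := by
  apply ContinuousOn.intervalIntegrable
  rw [Set.uIcc_of_le zero_le_one]
  exact ha.mul (h.continuousOn.pow 2)

lemma intervalIntegrable_mul_mul (h : IsH1 u g) {a : ℝ → ℝ}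
    (ha : ContinuousOn a (Set.Icc 0 1)) :
    IntervalIntegrable (fun x => a x * u x * g x) volume 0 1 := by
  apply h.intervalIntegrable.continuousOn_mul
  rw [Set.uIcc_of_le zero_le_one]
  exact ha.mul h.continuousOn

lemma intervalIntegrable_mul_sq_right (h : IsH1 u g) {a : ℝ → ℝ}
    (ha : ContinuousOn a (Set.Icc 0 1)) :
    IntervalIntegrable (fun x => a x * g x ^ 2) volume 0 1 := by
  apply h.intervalIntegrable_sq.continuousOn_mul
  rwa [Set.uIcc_of_le zero_le_one]

lemma energy_eq_add (h : IsH1 u g) (α β : ℝ) :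
    energy α β u g = α * (∫ x in (0 : ℝ)..1, weight β x * u x ^ 2)
      + ∫ x in (0 : ℝ)..1, weight β x * g x ^ 2 := by
  rw [energy_eq, ← intervalIntegral.integral_const_mul, ← intervalIntegral.integral_add]
  · congr 1; ext x; ring
  · exact (h.intervalIntegrable_mul_sq_left (continuous_weight β).continuousOn).const_mul α
  · exact h.intervalIntegrable_mul_sq_right (continuous_weight β).continuousOn

lemma energy_affine_left (h : IsH1 u g) (a b β θ : ℝ) :
    energy ((1 - θ) * a + θ * b) β u g = (1 - θ) * energy a β u g + θ * energy b β u g := by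
  simp only [h.energy_eq_add]; ring

lemma energy_affine_right (h : IsH1 u g) (α a b θ : ℝ) :
    energy α ((1 - θ) * a + θ * b) u g = (1 - θ) * energy α a u g + θ * energy α b u g := by
  have key : ∀ f : ℝ → ℝ, (∀ c, IntervalIntegrable (fun x => weight c x * f x) volume 0 1) →
      ∫ x in (0 : ℝ)..1, weight ((1 - θ) * a + θ * b) x * f x
        = (1 - θ) * (∫ x in (0 : ℝ)..1, weight a x * f x)
          + θ * ∫ x in (0 : ℝ)..1, weight b x * f x := by
    intro f hf
    rw [← intervalIntegral.integral_const_mul, ← intervalIntegral.integral_const_mul,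
      ← intervalIntegral.integral_add ((hf a).const_mul _) ((hf b).const_mul _)]
    congr 1; ext x; simp only [weight]; ring
  simp only [h.energy_eq_add]
  rw [key _ fun c => h.intervalIntegrable_mul_sq_left (continuous_weight c).continuousOn,
    key _ fun c => h.intervalIntegrable_mul_sq_right (continuous_weight c).continuousOn]
  ring

/-- Completing the square along a solution `r` of the Riccati equation, with `q` the
corresponding flux `weight β * r`. -/
lemma energy_eq_riccati (h : IsH1 u g) {α β : ℝ} {q r : ℝ → ℝ}
    (hq : ∀ x ∈ Set.Icc (0 : ℝ) 1, HasDerivAt q (α * weight β x - weight β x * r x ^ 2) x)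
    (hqr : ∀ x ∈ Set.Icc (0 : ℝ) 1, q x = weight β x * r x)
    (hr : ContinuousOn r (Set.Icc 0 1)) :
    energy α β u g = q 1 * u 1 ^ 2 - q 0 * u 0 ^ 2
      + ∫ x in (0 : ℝ)..1, weight β x * (g x - r x * u x) ^ 2 := by
  have hw : ContinuousOn (weight β) (Set.Icc 0 1) := (continuous_weight β).continuousOn
  have hq' : ContinuousOn (fun x => α * weight β x - weight β x * r x ^ 2) (Set.Icc 0 1) :=
    (continuousOn_const.mul hw).sub (hw.mul (hr.pow 2))
  rw [← h.integral_mul_sq hq hq', energy_eq, ← intervalIntegral.integral_add]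
  · apply integral_congr_Ioo
    intro x hx
    rw [hqr x (Set.Ioo_subset_Icc_self hx)]
    ring
  · have hqc : ContinuousOn q (Set.Icc 0 1) :=
      fun x hx => (hq x hx).continuousAt.continuousWithinAt
    exact (h.intervalIntegrable_mul_sq_left hq').add
      (h.intervalIntegrable_mul_mul (continuousOn_const.mul hqc))
  · have e : (fun x => weight β x * (g x - r x * u x) ^ 2) = fun x =>
        (weight β x * g x ^ 2 + (-2 * (weight β x * r x)) * u x * g x)
          + (weight β x * r x ^ 2) * u x ^ 2 := by
      ext x; ring
    rw [e]
    exact ((h.intervalIntegrable_mul_sq_right hw).add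
      (h.intervalIntegrable_mul_mul (continuousOn_const.mul (hw.mul hr)))).add
      (h.intervalIntegrable_mul_sq_left (hw.mul (hr.pow 2)))

end IsH1

/-! ### Lower bounds of the energy and their concavity -/

/-- `t` is a lower bound of the energy under the boundary conditions `u 0 = u 1 = 1`. -/
def EnergyGE (α β t : ℝ) : Prop :=
  ∀ u g : ℝ → ℝ, IsH1 u g → u 0 = 1 → u 1 = 1 → t ≤ energy α β u g

/-- Real-valued lower bounds replace the extended infimum from here on. If the infimum is `⊥` both
sides fail; the case `⊤` needs no exclusion because both sides then hold. -/
lemma zero_le_gap_iff {α β : ℝ} : 0 ≤ gap α β ↔ EnergyGE α β (α - β ^ 2) := by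
  have h1 : EnergyGE α β (α - β ^ 2) ↔ ((α - β ^ 2 : ℝ) : EReal) ≤ minEnergy α β := by
    rw [minEnergy, le_sInf_iff]
    constructor
    · rintro h t ⟨u, g, hu, h0, h1, rfl⟩
      exact EReal.coe_le_coe_iff.2 (h u g hu h0 h1)
    · intro h u g hu h0 h1
      exact EReal.coe_le_coe_iff.1 (h _ ⟨u, g, hu, h0, h1, rfl⟩)
  rw [h1, gap]
  induction minEnergy α β using EReal.rec with
  | bot =>
    rw [EReal.add_bot, EReal.bot_sub]
    exact iff_of_false (by simp) (not_le_of_gt (EReal.bot_lt_coe _))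
  | top =>
    rw [EReal.coe_add_top, EReal.top_sub_coe]
    exact iff_of_true le_top le_top
  | coe m =>
    rw [← EReal.coe_add, ← EReal.coe_sub, ← EReal.coe_zero, EReal.coe_le_coe_iff,
      EReal.coe_le_coe_iff]
    constructor <;> intro h <;> linarith

namespace EnergyGE

lemma mono {α β s t : ℝ} (h : EnergyGE α β t) (hst : s ≤ t) : EnergyGE α β s :=
  fun u g hu h0 h1 => hst.trans (h u g hu h0 h1)

/-- An infimum of functions affine in `α` is concave in `α`. The same argument in `β` gives
`affine_right`. -/
lemma affine_left {a b β s t θ : ℝ} (ha : EnergyGE a β s) (hb : EnergyGE b β t) (h0 : 0 ≤ θ)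
    (h1 : θ ≤ 1) : EnergyGE ((1 - θ) * a + θ * b) β ((1 - θ) * s + θ * t) := by
  intro u g hu hu0 hu1
  rw [hu.energy_affine_left]
  have h2 := mul_le_mul_of_nonneg_left (ha u g hu hu0 hu1) (sub_nonneg.2 h1)
  have h3 := mul_le_mul_of_nonneg_left (hb u g hu hu0 hu1) h0
  linarith

lemma affine_right {α a b s t θ : ℝ} (ha : EnergyGE α a s) (hb : EnergyGE α b t) (h0 : 0 ≤ θ)
    (h1 : θ ≤ 1) : EnergyGE α ((1 - θ) * a + θ * b) ((1 - θ) * s + θ * t) := by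
  intro u g hu hu0 hu1
  rw [hu.energy_affine_right]
  have h2 := mul_le_mul_of_nonneg_left (ha u g hu hu0 hu1) (sub_nonneg.2 h1)
  have h3 := mul_le_mul_of_nonneg_left (hb u g hu hu0 hu1) h0
  linarith

end EnergyGE

/-! ### The weights at `β = 1` and `β = coth ½`; bounds from Riccati solutions -/

lemma sinh_half_pos : 0 < Real.sinh (1 / 2) := Real.sinh_pos_iff.2 (by norm_num)

lemma weight_one (x : ℝ) : weight 1 x = Real.exp (x - 1 / 2) / (2 * Real.sinh (1 / 2)) := by
  rw [weight, one_mul, Real.cosh_add_sinh]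

/-- The reflection `x ↦ 1 - x` of the interval exchanges `β` and `-β`. -/
lemma weight_neg (β x : ℝ) : weight (-β) x = weight β (1 - x) := by
  have : (1 - x - 1 / 2 : ℝ) = -(x - 1 / 2) := by ring
  rw [weight, weight, this, Real.cosh_neg, Real.sinh_neg]
  ring

lemma kappa_eq : kappa = Real.cosh (1 / 2) / Real.sinh (1 / 2) := by
  have h : Real.exp 1 = Real.exp (1 / 2) * Real.exp (1 / 2) := by
    rw [← Real.exp_add]; norm_num
  have hp := Real.exp_pos (1 / 2)
  have h1 : 1 < Real.exp (1 / 2) := Real.one_lt_exp_iff.2 (by norm_num)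
  have h2 : Real.exp (1 / 2) * Real.exp (1 / 2) - 1 ≠ 0 := by nlinarith
  rw [kappa, Real.cosh_eq, Real.sinh_eq, h, Real.exp_neg]
  field_simp

/-- The addition formula for `sinh`. The weight vanishes at `0`, so `κ` is the largest `β` for which
it is nonnegative on `[0,1]`. -/
lemma weight_kappa (x : ℝ) : weight kappa x = Real.sinh x / (2 * Real.sinh (1 / 2) ^ 2) := by
  have h : Real.sinh x = Real.sinh ((x - 1 / 2) + 1 / 2) := by congr 1; ring
  have hs := sinh_half_pos.ne'
  rw [h, Real.sinh_add, weight, kappa_eq]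
  field_simp
  ring

lemma weight_one_nonneg (x : ℝ) : 0 ≤ weight 1 x := by
  rw [weight_one]
  exact div_nonneg (Real.exp_pos _).le (mul_pos two_pos sinh_half_pos).le

lemma weight_kappa_nonneg {x : ℝ} (hx : 0 ≤ x) : 0 ≤ weight kappa x := by
  rw [weight_kappa]
  exact div_nonneg (Real.sinh_nonneg_iff.2 hx) (by positivity)

lemma energyGE_of_riccati {α β : ℝ} {q r : ℝ → ℝ}
    (hw : ∀ x ∈ Set.Icc (0 : ℝ) 1, 0 ≤ weight β x)
    (hq : ∀ x ∈ Set.Icc (0 : ℝ) 1, HasDerivAt q (α * weight β x - weight β x * r x ^ 2) x)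
    (hqr : ∀ x ∈ Set.Icc (0 : ℝ) 1, q x = weight β x * r x)
    (hr : ContinuousOn r (Set.Icc 0 1)) : EnergyGE α β (q 1 - q 0) := by
  intro u g hu h0 h1
  rw [hu.energy_eq_riccati hq hqr hr, h0, h1]
  have : 0 ≤ ∫ x in (0 : ℝ)..1, weight β x * (g x - r x * u x) ^ 2 :=
    intervalIntegral.integral_nonneg zero_le_one fun x hx =>
      mul_nonneg (hw x hx) (sq_nonneg _)
  linarith

/-- The lower bound given by a Riccati solution also holds for the reflected weight. -/
lemma energyGE_neg_of_riccati {α β : ℝ} {q r : ℝ → ℝ}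
    (hw : ∀ x ∈ Set.Icc (0 : ℝ) 1, 0 ≤ weight β x)
    (hq : ∀ x ∈ Set.Icc (0 : ℝ) 1, HasDerivAt q (α * weight β x - weight β x * r x ^ 2) x)
    (hqr : ∀ x ∈ Set.Icc (0 : ℝ) 1, q x = weight β x * r x)
    (hr : ContinuousOn r (Set.Icc 0 1)) : EnergyGE α (-β) (q 1 - q 0) := by
  have hm : ∀ x ∈ Set.Icc (0 : ℝ) 1, 1 - x ∈ Set.Icc (0 : ℝ) 1 := fun x hx =>
    ⟨by linarith [hx.2], by linarith [hx.1]⟩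
  have := energyGE_of_riccati (α := α) (β := -β) (q := fun x => -q (1 - x))
    (r := fun x => -r (1 - x)) ?_ ?_ ?_ ?_
  · convert this using 1
    norm_num
    ring
  · intro x hx; rw [weight_neg]; exact hw _ (hm x hx)
  · intro x hx
    have h1 : HasDerivAt (fun x : ℝ => 1 - x) (-1) x := by
      simpa using (hasDerivAt_id x).const_sub 1
    have h2 := ((hq _ (hm x hx)).comp x h1).neg
    refine h2.congr_deriv ?_
    rw [weight_neg]; ring
  · intro x hx
    rw [weight_neg, hqr _ (hm x hx)]; ring
  · exact (hr.comp (continuousOn_const.sub continuousOn_id) hm).neg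

lemma energyGE_zero {β : ℝ} (hw : ∀ x ∈ Set.Icc (0 : ℝ) 1, 0 ≤ weight β x) :
    EnergyGE 0 β 0 := by
  intro u g hu _ _
  rw [hu.energy_eq_add, zero_mul, zero_add]
  exact intervalIntegral.integral_nonneg zero_le_one fun x hx => mul_nonneg (hw x hx) (sq_nonneg _)

/-! ### The set of admissible `α` is a compact interval -/

lemma mem_admissible {α β : ℝ} : α ∈ admissible β ↔ EnergyGE α β (α - β ^ 2) := zero_le_gap_iff

lemma convex_admissible (β : ℝ) : Convex ℝ (admissible β) := by
  intro x hx y hy a b _ hb hab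
  rw [mem_admissible] at *
  obtain rfl : a = 1 - b := by linarith
  have := hx.affine_left hy hb (by linarith)
  simp only [smul_eq_mul]
  convert this using 1
  ring

/-- For each fixed competitor the condition on `α` is a closed affine inequality, and the set is the
intersection of these. -/
lemma isClosed_admissible (β : ℝ) : IsClosed (admissible β) := by
  have : admissible β = ⋂ (u : ℝ → ℝ) (g : ℝ → ℝ) (_ : IsH1 u g) (_ : u 0 = 1) (_ : u 1 = 1),
      {α | α - β ^ 2 ≤ energy α β u g} := by
    ext α
    rw [mem_admissible]
    simp only [Set.mem_iInter, Set.mem_ofPred_eq, EnergyGE]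
  rw [this]
  refine isClosed_iInter fun u => isClosed_iInter fun g => isClosed_iInter fun hu =>
    isClosed_iInter fun _ => isClosed_iInter fun _ => ?_
  simp only [hu.energy_eq_add]
  exact isClosed_le (by fun_prop) (by fun_prop)

section Interval

variable {β a b : ℝ}

/-- The set is convex and contains `0`, so one point outside it on each side confines it.
Compactness and all the decimal bounds reduce to testing single values of `α`. -/
lemma lt_of_mem_admissible (h0 : (0 : ℝ) ∈ admissible β) (ha : a < 0) (ha' : a ∉ admissible β)
    {x : ℝ} (hx : x ∈ admissible β) : a < x := by
  by_contra h
  exact ha' ((convex_admissible β).ordConnected.out hx h0 ⟨not_lt.1 h, ha.le⟩)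

lemma gt_of_mem_admissible (h0 : (0 : ℝ) ∈ admissible β) (hb : 0 < b) (hb' : b ∉ admissible β)
    {x : ℝ} (hx : x ∈ admissible β) : x < b := by
  by_contra h
  exact hb' ((convex_admissible β).ordConnected.out h0 hx ⟨hb.le, not_lt.1 h⟩)

lemma isCompact_admissible (h0 : (0 : ℝ) ∈ admissible β) (ha : a < 0) (ha' : a ∉ admissible β)
    (hb : 0 < b) (hb' : b ∉ admissible β) : IsCompact (admissible β) :=
  isCompact_Icc.of_isClosed_subset (isClosed_admissible β) fun _ hx =>
    ⟨(lt_of_mem_admissible h0 ha ha' hx).le, (gt_of_mem_admissible h0 hb hb' hx).le⟩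

lemma admissible_eq_Icc (h0 : (0 : ℝ) ∈ admissible β) (ha : a < 0) (ha' : a ∉ admissible β)
    (hb : 0 < b) (hb' : b ∉ admissible β) :
    admissible β = Set.Icc (alphaMinus β) (alphaPlus β) :=
  eq_Icc_of_connected_compact ⟨⟨0, h0⟩, (convex_admissible β).isPreconnected⟩
    (isCompact_admissible h0 ha ha' hb hb')

end Interval

/-! ### The case `β = 1`: constant coefficients -/

/-- The entire function `m ↦ cosh √m`. -/
def coshSqrt (m : ℝ) : ℝ := ∑' k : ℕ, m ^ k / ((2 * k).factorial : ℝ)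

/-- The entire function `m ↦ sinh √m / √m`. -/
def sinhcSqrt (m : ℝ) : ℝ := ∑' k : ℕ, m ^ k / ((2 * k + 1).factorial : ℝ)

/-- Only even powers of `μ` occur, so the value depends on `μ²` alone. Hence the result is real and
the choice of the complex square root is immaterial. -/
lemma hasSum_coshSqrt_ofReal {m : ℝ} {μ : ℂ} (hμ : μ ^ 2 = m) :
    HasSum (fun k : ℕ => ((m ^ k / ((2 * k).factorial : ℝ) : ℝ) : ℂ)) (Complex.cosh μ) := by
  convert Complex.hasSum_cosh μ using 2 with k
  rw [pow_mul, hμ]; push_cast; rfl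

lemma hasSum_sinhcSqrt_ofReal {m : ℝ} {μ : ℂ} (hμ : μ ^ 2 = m) (h0 : μ ≠ 0) :
    HasSum (fun k : ℕ => ((m ^ k / ((2 * k + 1).factorial : ℝ) : ℝ) : ℂ))
      (Complex.sinh μ / μ) := by
  have e : (fun k : ℕ => ((m ^ k / ((2 * k + 1).factorial : ℝ) : ℝ) : ℂ)) =
      fun k : ℕ => μ ^ (2 * k + 1) / ((2 * k + 1).factorial : ℂ) / μ := by
    ext k
    rw [pow_succ, pow_mul, hμ]; push_cast; field_simp
  rw [e]
  exact (Complex.hasSum_sinh μ).div_const μ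

lemma exists_sq_eq (m : ℝ) : ∃ μ : ℂ, μ ^ 2 = m :=
  IsAlgClosed.exists_pow_nat_eq _ two_pos

lemma hasSum_coshSqrt (m : ℝ) :
    HasSum (fun k : ℕ => m ^ k / ((2 * k).factorial : ℝ)) (coshSqrt m) := by
  obtain ⟨μ, h⟩ := exists_sq_eq m
  exact (Complex.summable_ofReal.1 (hasSum_coshSqrt_ofReal h).summable).hasSum

lemma hasSum_sinhcSqrt (m : ℝ) :
    HasSum (fun k : ℕ => m ^ k / ((2 * k + 1).factorial : ℝ)) (sinhcSqrt m) := by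
  obtain ⟨μ, h⟩ := exists_sq_eq m
  rcases eq_or_ne μ 0 with rfl | h0
  · have : m = 0 := by simpa using h.symm
    subst this
    refine (summable_of_ne_finset_zero (s := {0}) fun k hk => ?_).hasSum
    simp only [Finset.mem_singleton] at hk
    simp [hk]
  · exact (Complex.summable_ofReal.1 (hasSum_sinhcSqrt_ofReal h h0).summable).hasSum

lemma cosh_eq_coshSqrt {m : ℝ} {μ : ℂ} (hμ : μ ^ 2 = m) : Complex.cosh μ = coshSqrt m :=
  (hasSum_coshSqrt_ofReal hμ).unique (Complex.hasSum_ofReal.2 (hasSum_coshSqrt m))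

lemma sinh_eq_sinhcSqrt {m : ℝ} {μ : ℂ} (hμ : μ ^ 2 = m) :
    Complex.sinh μ = μ * sinhcSqrt m := by
  rcases eq_or_ne μ 0 with rfl | h0
  · simp
  · rw [← (hasSum_sinhcSqrt_ofReal hμ h0).unique (Complex.hasSum_ofReal.2 (hasSum_sinhcSqrt m))]
    field_simp

lemma sinhcSqrt_zero : sinhcSqrt 0 = 1 := by
  refine (hasSum_sinhcSqrt 0).unique ?_
  convert hasSum_single (f := fun k : ℕ => (0 : ℝ) ^ k / ((2 * k + 1).factorial : ℝ)) 0 ?_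
  · simp
  · intro k hk; simp [hk]

lemma coshSqrt_zero : coshSqrt 0 = 1 := by
  have := cosh_eq_coshSqrt (m := 0) (μ := 0) (by simp)
  rw [Complex.cosh_zero] at this
  exact_mod_cast this.symm

lemma coshSqrt_neg_sq (θ : ℝ) : coshSqrt (-θ ^ 2) = Real.cos θ := by
  have h := cosh_eq_coshSqrt (m := -θ ^ 2) (μ := θ * Complex.I) (by
    rw [mul_pow, Complex.I_sq]; push_cast; ring)
  rw [Complex.cosh_mul_I] at h
  exact_mod_cast h.symm

lemma mul_sinhcSqrt_neg_sq (θ : ℝ) : θ * sinhcSqrt (-θ ^ 2) = Real.sin θ := by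
  have h := sinh_eq_sinhcSqrt (m := -θ ^ 2) (μ := θ * Complex.I) (by
    rw [mul_pow, Complex.I_sq]; push_cast; ring)
  rw [Complex.sinh_mul_I, mul_right_comm] at h
  exact_mod_cast (mul_right_cancel₀ Complex.I_ne_zero h).symm

lemma coshSqrt_sq (θ : ℝ) : coshSqrt (θ ^ 2) = Real.cosh θ := by
  have h := cosh_eq_coshSqrt (m := θ ^ 2) (μ := θ) (by push_cast; ring)
  exact_mod_cast h.symm

lemma mul_sinhcSqrt_sq (θ : ℝ) : θ * sinhcSqrt (θ ^ 2) = Real.sinh θ := by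
  have h := sinh_eq_sinhcSqrt (m := θ ^ 2) (μ := θ) (by push_cast; ring)
  exact_mod_cast h.symm

/-- Fundamental solutions of `y'' = m y`. -/
lemma exists_fundamental_solutions {m : ℝ} (hm : -Real.pi ^ 2 < m) :
    ∃ C S : ℝ → ℝ, (∀ x, HasDerivAt S (C x) x) ∧ (∀ x, HasDerivAt C (m * S x) x) ∧
      S 0 = 0 ∧ C 0 = 1 ∧ (∀ x, 0 < x → x ≤ 1 → 0 < S x) ∧ C 1 = coshSqrt m ∧
      S 1 = sinhcSqrt m := by
  have hlin : ∀ θ x : ℝ, HasDerivAt (fun y => θ * y) θ x := fun θ x => by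
    simpa using (hasDerivAt_id x).const_mul θ
  rcases lt_trichotomy m 0 with h | rfl | h
  · set θ := Real.sqrt (-m) with hθ
    have hθ0 : 0 < θ := Real.sqrt_pos.2 (by linarith)
    have hsq : θ ^ 2 = -m := Real.sq_sqrt (by linarith)
    have hθπ : θ < Real.pi := by
      by_contra hc
      nlinarith [Real.pi_pos, not_lt.1 hc]
    have hm' : m = -θ ^ 2 := by linarith
    refine ⟨fun x => Real.cos (θ * x), fun x => Real.sin (θ * x) / θ, fun x => ?_, fun x => ?_,
      by simp, by simp, fun x hx hx1 => ?_, ?_, ?_⟩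
    · refine ((hlin θ x).sin.div_const θ).congr_deriv ?_
      field_simp
    · refine (hlin θ x).cos.congr_deriv ?_
      rw [hm']; field_simp
    · refine div_pos (Real.sin_pos_of_pos_of_lt_pi (by positivity) ?_) hθ0
      nlinarith
    · simp only [mul_one]; rw [hm', coshSqrt_neg_sq]
    · simp only [mul_one]; rw [hm', ← mul_sinhcSqrt_neg_sq]; field_simp
  · refine ⟨fun _ => 1, fun x => x, fun x => hasDerivAt_id x, fun x => ?_, rfl, rfl,
      fun x hx _ => hx, coshSqrt_zero.symm, sinhcSqrt_zero.symm⟩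
    rw [zero_mul]; exact hasDerivAt_const _ _
  · set θ := Real.sqrt m with hθ
    have hθ0 : 0 < θ := Real.sqrt_pos.2 h
    have hm' : m = θ ^ 2 := (Real.sq_sqrt h.le).symm
    refine ⟨fun x => Real.cosh (θ * x), fun x => Real.sinh (θ * x) / θ, fun x => ?_, fun x => ?_,
      by simp, by simp, fun x hx hx1 => ?_, ?_, ?_⟩
    · refine ((hlin θ x).sinh.div_const θ).congr_deriv ?_
      field_simp
    · refine (hlin θ x).cosh.congr_deriv ?_
      rw [hm']; field_simp
    · exact div_pos (Real.sinh_pos_iff.2 (by positivity)) hθ0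
    · simp only [mul_one]; rw [hm', coshSqrt_sq]
    · simp only [mul_one]; rw [hm', ← mul_sinhcSqrt_sq]; field_simp

/-- The value of `I(α, 1)`. -/
def minOne (α : ℝ) : ℝ :=
  -1 / 2 + (Real.cosh (1 / 2) * coshSqrt (α + 1 / 4) - 1) /
    (Real.sinh (1 / 2) * sinhcSqrt (α + 1 / 4))

lemma sinhcSqrt_pos {m : ℝ} (hm : -Real.pi ^ 2 < m) : 0 < sinhcSqrt m := by
  obtain ⟨C, S, -, -, -, -, hpos, -, hS⟩ := exists_fundamental_solutions hm
  rw [← hS]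
  exact hpos 1 one_pos le_rfl

lemma hypTerm_eq {α : ℝ} (hα : -Real.pi ^ 2 < α + 1 / 4) {μ : ℂ} (hμ : μ ^ 2 = (α + 1 / 4 : ℝ)) :
    hypTerm μ = ((minOne α + 1 / 2 : ℝ) : ℂ) := by
  have hs : (sinhcSqrt (α + 1 / 4) : ℂ) ≠ 0 := by
    exact_mod_cast (sinhcSqrt_pos hα).ne'
  have e : minOne α + 1 / 2 = (Real.cosh (1 / 2) * coshSqrt (α + 1 / 4) - 1) /
    (Real.sinh (1 / 2) * sinhcSqrt (α + 1 / 4)) := by rw [minOne]; ring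
  rw [hypTerm, e]
  split_ifs with h0
  · have : α + 1 / 4 = 0 := by
      rw [h0] at hμ
      exact_mod_cast (by simpa using hμ.symm : ((α + 1 / 4 : ℝ) : ℂ) = 0)
    rw [this, sinhcSqrt_zero, coshSqrt_zero]
    push_cast; simp
  · rw [cosh_eq_coshSqrt hμ, sinh_eq_sinhcSqrt hμ]
    push_cast
    have h2 : Complex.sinh (1 / 2) ≠ 0 := by
      have := sinh_half_pos.ne'
      have h3 : ((Real.sinh (1 / 2) : ℝ) : ℂ) ≠ 0 := by exact_mod_cast this
      simpa using h3
    field_simp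

/-- The solution of the Euler-Lagrange equation for `β = 1`, through its flux and its logarithmic
derivative. -/
lemma exists_minimizer_one {α : ℝ} (hα : -Real.pi ^ 2 < α + 1 / 4) :
    ∃ q r h : ℝ → ℝ, q 1 - q 0 = minOne α ∧
      (∀ x ∈ Set.Icc (0 : ℝ) 1,
        HasDerivAt q (α * weight 1 x - weight 1 x * r x ^ 2) x) ∧
      (∀ x ∈ Set.Icc (0 : ℝ) 1, q x = weight 1 x * r x) ∧
      ContinuousOn r (Set.Icc 0 1) ∧ h 0 = 1 ∧ h 1 = 1 ∧
      ∀ x ∈ Set.Icc (0 : ℝ) 1, HasDerivAt h (r x * h x) x := by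
  obtain ⟨C, S, hS, hC, hS0, hC0, hpos, hC1, hS1⟩ := exists_fundamental_solutions hα
  set m := α + 1 / 4 with hm
  have hS1pos : 0 < S 1 := hpos 1 one_pos le_rfl
  set E := Real.exp (1 / 2) with hE
  have hEpos : 0 < E := Real.exp_pos _
  -- The substitution `u = e^{-x/2} v` turns `u'' + u' = α u` into `v'' = m v`. This `v` has `v 0 =
  -- 1` and `v 1 = e^{1/2}`, which means `u = 1` at both ends; positivity of `S` on `(0,1]` makes
  -- `v` positive.
  set v : ℝ → ℝ := fun x => (S (1 - x) + E * S x) / S 1 with hv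
  set v' : ℝ → ℝ := fun x => (-C (1 - x) + E * C x) / S 1 with hv'
  have hsub : ∀ x : ℝ, HasDerivAt (fun x : ℝ => 1 - x) (-1) x := fun x => by
    simpa using (hasDerivAt_id x).const_sub 1
  have dv : ∀ x, HasDerivAt v (v' x) x := fun x => by
    refine ((((hS (1 - x)).comp x (hsub x)).add ((hS x).const_mul E)).div_const (S 1)).congr_deriv ?_
    simp only [hv']; ring
  have dv' : ∀ x, HasDerivAt v' (m * v x) x := fun x => by
    refine ((((hC (1 - x)).comp x (hsub x)).neg.add
      ((hC x).const_mul E)).div_const (S 1)).congr_deriv ?_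
    simp only [hv]; ring
  have vpos : ∀ x ∈ Set.Icc (0 : ℝ) 1, 0 < v x := by
    intro x hx
    refine div_pos ?_ hS1pos
    have hnn : ∀ y, 0 ≤ y → y ≤ 1 → 0 ≤ S y := fun y h0 h1 => by
      rcases h0.eq_or_lt with rfl | h
      · exact hS0.ge
      · exact (hpos y h h1).le
    rcases hx.1.eq_or_lt with rfl | h
    · rw [hS0, sub_zero]; simpa using hS1pos
    · have h1 := hpos x h hx.2
      have h2 := hnn (1 - x) (by linarith [hx.2]) (by linarith)
      positivity
  have de : ∀ x : ℝ, HasDerivAt (fun x : ℝ => Real.exp (-x / 2)) (Real.exp (-x / 2) * (-1 / 2)) x :=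
    fun x => ((hasDerivAt_id x).neg.div_const 2).exp
  have dw : ∀ x : ℝ, HasDerivAt (weight 1) (weight 1 x) x := fun x => by
    have h1 : weight 1 = fun x => Real.exp (x - 1 / 2) / (2 * Real.sinh (1 / 2)) :=
      funext weight_one
    rw [h1]
    refine (((hasDerivAt_id x).sub_const (1 / 2)).exp.div_const _).congr_deriv ?_
    simp
  -- The logarithmic derivative of `e^{-x/2} v`.
  set r : ℝ → ℝ := fun x => -1 / 2 + v' x / v x with hr
  have dr : ∀ x ∈ Set.Icc (0 : ℝ) 1, HasDerivAt r (m - (v' x / v x) ^ 2) x := by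
    intro x hx
    have h0 := (vpos x hx).ne'
    refine (((dv' x).div (dv x) h0).const_add (-1 / 2)).congr_deriv ?_
    field_simp
  refine ⟨fun x => weight 1 x * r x, r, fun x => Real.exp (-x / 2) * v x, ?_, ?_, fun _ _ => rfl,
    fun x hx => (dr x hx).continuousAt.continuousWithinAt, ?_, ?_, ?_⟩
  · have hsh : Real.sinh (1 / 2) = (E - E⁻¹) / 2 := by rw [Real.sinh_eq, Real.exp_neg]
    have hch : Real.cosh (1 / 2) = (E + E⁻¹) / 2 := by rw [Real.cosh_eq, Real.exp_neg]
    have hw1 : weight 1 1 = E / (E - E⁻¹) := by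
      rw [weight_one, hsh, hE]; norm_num; ring
    have hw0 : weight 1 0 = E⁻¹ / (E - E⁻¹) := by
      rw [weight_one, hsh, hE, ← Real.exp_neg]; norm_num; ring
    have h1 : 1 < E := Real.one_lt_exp_iff.2 (by norm_num)
    have h2 : E * E - 1 ≠ 0 := by nlinarith
    have h3 : E ^ 2 - 1 ≠ 0 := by nlinarith
    have hpos' := hS1pos.ne'
    rw [minOne, ← hC1, ← hS1, hsh, hch]
    simp only [hw1, hw0]
    simp only [hr, hv, hv', sub_self, sub_zero, hS0, hC0]
    field_simp
    ring
  · intro x hx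
    refine ((dw x).mul (dr x hx)).congr_deriv ?_
    simp only [hr, hm]; ring
  · simp only [hv, hS0, sub_zero, mul_zero, add_zero]
    rw [div_self hS1pos.ne']; simp
  · simp only [hv, sub_self, hS0, zero_add]
    rw [mul_div_assoc, div_self hS1pos.ne', mul_one, hE, ← Real.exp_add]
    norm_num
  · intro x hx
    have h0 := (vpos x hx).ne'
    refine ((de x).mul (dv x)).congr_deriv ?_
    simp only [hr]
    field_simp

lemma energyGE_minOne {α : ℝ} (hα : -Real.pi ^ 2 < α + 1 / 4) :
    EnergyGE α 1 (minOne α) ∧ EnergyGE α (-1) (minOne α) := by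
  obtain ⟨q, r, h, hmin, hq, hqr, hr, -⟩ := exists_minimizer_one hα
  rw [← hmin]
  exact ⟨energyGE_of_riccati (fun x _ => weight_one_nonneg x) hq hqr hr,
    energyGE_neg_of_riccati (fun x _ => weight_one_nonneg x) hq hqr hr⟩

/-- The minimizer `h` satisfies `h' = r h`, so the square in the Riccati identity vanishes and the
bound is attained. -/
lemma energyGE_one_iff {α t : ℝ} (hα : -Real.pi ^ 2 < α + 1 / 4) :
    EnergyGE α 1 t ↔ t ≤ minOne α := by
  refine ⟨fun hE => ?_, (energyGE_minOne hα).1.mono⟩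
  obtain ⟨q, r, h, hmin, hq, hqr, hr, h0, h1, dh⟩ := exists_minimizer_one hα
  have hH : IsH1 h (fun x => r x * h x) :=
    isH1_of_hasDerivAt dh (hr.mul fun x hx => (dh x hx).continuousAt.continuousWithinAt)
  have := hE _ _ hH h0 h1
  rw [hH.energy_eq_riccati hq hqr hr, h0, h1] at this
  simpa [hmin] using this

/-- The bound at `β = 1` holds on the whole range `|β| ≤ 1`. -/
lemma energyGE_of_abs_le_one {α β : ℝ} (hα : -Real.pi ^ 2 < α + 1 / 4) (h1 : -1 ≤ β)
    (h2 : β ≤ 1) : EnergyGE α β (minOne α) := by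
  -- The bounds at `β = -1` and `β = 1` coincide, so the chord between them is constant.
  have h := (energyGE_minOne hα).2.affine_right (energyGE_minOne hα).1 (θ := (1 + β) / 2)
    (by linarith) (by linarith)
  convert h using 1 <;> ring

/-! ### The regular Legendre solution as a power series -/

/-- The Taylor coefficients at `s = 0` of the solution of `(s (1 + s) y')' = α y`, `y 0 = 1`. -/
def legCoeff (α : ℝ) : ℕ → ℝ
  | 0 => 1
  | n + 1 => legCoeff α n * ((α - n * (n + 1)) / (n + 1) ^ 2)

/-- The solution of `(s (1 + s) y')' = α y` that is regular at `0`. -/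
def legSol (α s : ℝ) : ℝ := ∑' n : ℕ, legCoeff α n * s ^ n

/-- The derivative of `legSol`. -/
def legSolDeriv (α s : ℝ) : ℝ := ∑' n : ℕ, legCoeff α n * (n * s ^ (n - 1))

/-- The primitive of `legSol` that vanishes at `0`. -/
def legSolInt (α s : ℝ) : ℝ := ∑' n : ℕ, legCoeff α n * (s ^ (n + 1) / (n + 1))

/-- Once `n ≥ |α|` the ratio of consecutive coefficients is bounded, and the finitely many earlier
ones go into `K`. Any growth rate below `2` serves, since the series is only used for `|s| ≤ 1/2`.
-/
lemma exists_legCoeff_bound (α : ℝ) :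
    ∃ K : ℝ, 0 ≤ K ∧ ∀ n, |legCoeff α n| ≤ K * (3 / 2) ^ n := by
  obtain ⟨N, hN⟩ := exists_nat_ge |α|
  set K := ∑ i ∈ Finset.range (N + 1), |legCoeff α i| with hK
  have hK0 : 0 ≤ K := Finset.sum_nonneg fun _ _ => abs_nonneg _
  refine ⟨K, hK0, fun n => ?_⟩
  induction n with
  | zero =>
    rw [pow_zero, mul_one]
    exact Finset.single_le_sum (f := fun i => |legCoeff α i|) (fun _ _ => abs_nonneg _)
      (Finset.mem_range.2 N.succ_pos)
  | succ n ih =>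
    rcases lt_or_ge (n + 1) (N + 1) with h | h
    · have h1 : |legCoeff α (n + 1)| ≤ K :=
        Finset.single_le_sum (f := fun i => |legCoeff α i|) (fun _ _ => abs_nonneg _)
          (Finset.mem_range.2 h)
      exact h1.trans (le_mul_of_one_le_right hK0 (one_le_pow₀ (by norm_num)))
    · have hn : |α| ≤ n := hN.trans (by exact_mod_cast Nat.succ_le_succ_iff.1 h)
      have h2 : |(α - n * (n + 1)) / ((n : ℝ) + 1) ^ 2| ≤ 3 / 2 := by
        rw [abs_div, abs_of_pos (by positivity : (0 : ℝ) < ((n : ℝ) + 1) ^ 2),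
          div_le_iff₀ (by positivity)]
        have h3 := abs_le.1 hn
        have h4 : (0 : ℝ) ≤ n := n.cast_nonneg
        rw [abs_le]; constructor <;> nlinarith
      rw [legCoeff, abs_mul, pow_succ (3 / 2 : ℝ), ← mul_assoc]
      exact mul_le_mul ih h2 (abs_nonneg _) (by positivity)

lemma summable_majorant (K : ℝ) :
    Summable fun n : ℕ => K * (3 / 2 : ℝ) ^ n * (n * (1 / 2 : ℝ) ^ (n - 1)) := by
  have h := (summable_pow_mul_geometric_of_norm_lt_one 1
    (r := (3 / 4 : ℝ)) (by norm_num)).mul_left (2 * K)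
  refine h.congr fun n => ?_
  rcases n with _ | n
  · simp
  · have : (3 / 4 : ℝ) ^ (n + 1) = (3 / 2) ^ (n + 1) * ((1 / 2) ^ n * (1 / 2)) := by
      rw [← pow_succ, ← mul_pow]; norm_num
    rw [this]; simp; ring

section PowerSeries

variable {𝕜 : Type*} [RCLike 𝕜] {a : ℕ → 𝕜} {K : ℝ}

lemma norm_mul_natCast_mul_pow_le (ha : ∀ n, ‖a n‖ ≤ K * (3 / 2) ^ n) (hK : 0 ≤ K) {z : 𝕜}
    (hz : ‖z‖ ≤ 1 / 2) (n : ℕ) :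
    ‖a n * (n * z ^ (n - 1))‖ ≤ K * (3 / 2 : ℝ) ^ n * (n * (1 / 2 : ℝ) ^ (n - 1)) := by
  rw [norm_mul, norm_mul, norm_pow, RCLike.norm_natCast]
  have := pow_le_pow_left₀ (norm_nonneg z) hz (n - 1)
  have h2 := ha n
  gcongr

lemma hasDerivAt_tsum_mul_pow (ha : ∀ n, ‖a n‖ ≤ K * (3 / 2) ^ n) (hK : 0 ≤ K) {z : 𝕜}
    (hz : ‖z‖ < 1 / 2) :
    HasDerivAt (fun z => ∑' n, a n * z ^ n) (∑' n, a n * (n * z ^ (n - 1))) z := by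
  refine hasDerivAt_tsum_of_isPreconnected (t := Metric.ball (0 : 𝕜) (1 / 2)) (y₀ := 0)
    (summable_majorant K) Metric.isOpen_ball ?_ (fun n y _ => (hasDerivAt_pow n y).const_mul _)
    (fun n y hy => norm_mul_natCast_mul_pow_le ha hK (mem_ball_zero_iff.1 hy).le n)
    (Metric.mem_ball_self (by norm_num)) ?_ (mem_ball_zero_iff.2 hz)
  · let _ : NormedSpace ℝ 𝕜 := NormedSpace.restrictScalars ℝ 𝕜 𝕜
    exact (convex_ball (0 : 𝕜) (1 / 2)).isPreconnected
  · refine summable_of_ne_finset_zero (s := {0}) fun k hk => ?_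
    simp only [Finset.mem_singleton] at hk
    simp [hk]

end PowerSeries

section Real

variable {α s : ℝ}

lemma hasDerivAt_legSol (hs : |s| < 1 / 2) : HasDerivAt (legSol α) (legSolDeriv α s) s := by
  obtain ⟨K, hK, hb⟩ := exists_legCoeff_bound α
  exact hasDerivAt_tsum_mul_pow (𝕜 := ℝ) (a := legCoeff α) hb hK hs

lemma continuousOn_legSolDeriv : ContinuousOn (legSolDeriv α) (Set.Icc (-(1 / 2)) (1 / 2)) := by
  obtain ⟨K, hK, hb⟩ := exists_legCoeff_bound α
  refine continuousOn_tsum (fun n => by fun_prop) (summable_majorant K) fun n x hx => ?_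
  exact norm_mul_natCast_mul_pow_le (𝕜 := ℝ) (a := legCoeff α) hb hK (abs_le.2 hx) n

lemma summable_legSolDeriv (hs : |s| < 1 / 2) :
    Summable fun n : ℕ => legCoeff α n * (n * s ^ (n - 1)) := by
  obtain ⟨K, hK, hb⟩ := exists_legCoeff_bound α
  exact .of_norm_bounded (summable_majorant K) fun n =>
    norm_mul_natCast_mul_pow_le (𝕜 := ℝ) (a := legCoeff α) hb hK hs.le n

lemma norm_legCoeff_mul_pow_le {K : ℝ} (hb : ∀ n, |legCoeff α n| ≤ K * (3 / 2) ^ n) (hK : 0 ≤ K)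
    (hs : |s| ≤ 1 / 2) (n : ℕ) : ‖legCoeff α n * s ^ n‖ ≤ K * (3 / 4 : ℝ) ^ n := by
  have : (3 / 4 : ℝ) ^ n = (3 / 2) ^ n * (1 / 2) ^ n := by rw [← mul_pow]; norm_num
  rw [norm_mul, norm_pow, Real.norm_eq_abs, Real.norm_eq_abs, this, ← mul_assoc]
  have := hb n
  have := pow_le_pow_left₀ (abs_nonneg s) hs n
  gcongr

lemma hasSum_legSol (hs : |s| < 1 / 2) :
    HasSum (fun n : ℕ => legCoeff α n * s ^ n) (legSol α s) := by
  obtain ⟨K, hK, hb⟩ := exists_legCoeff_bound α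
  exact (Summable.of_norm_bounded ((summable_geometric_of_lt_one (by norm_num)
    (by norm_num)).mul_left K) (norm_legCoeff_mul_pow_le hb hK hs.le)).hasSum

lemma hasSum_legSolInt (hs : |s| < 1 / 2) :
    HasSum (fun n : ℕ => legCoeff α n * (s ^ (n + 1) / (n + 1))) (legSolInt α s) := by
  refine (Summable.of_norm_bounded (hasSum_legSol (α := α) hs).summable.norm fun n => ?_).hasSum
  rw [norm_mul, norm_mul]
  refine mul_le_mul_of_nonneg_left ?_ (norm_nonneg _)
  rw [pow_succ, norm_div, norm_mul]
  have h1 : ‖s‖ ≤ 1 := by rw [Real.norm_eq_abs]; linarith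
  have h2 : (1 : ℝ) ≤ ‖(n : ℝ) + 1‖ := by
    rw [Real.norm_eq_abs, abs_of_nonneg (by positivity)]; linarith [(n.cast_nonneg : (0 : ℝ) ≤ n)]
  rw [div_le_iff₀ (by linarith)]
  exact mul_le_mul_of_nonneg_left (h1.trans h2) (norm_nonneg _)

lemma hasDerivAt_legSolInt (hs : |s| < 1 / 2) : HasDerivAt (legSolInt α) (legSol α s) s := by
  obtain ⟨K, hK, hb⟩ := exists_legCoeff_bound α
  refine hasDerivAt_tsum_of_isPreconnected (t := Metric.ball (0 : ℝ) (1 / 2)) (y₀ := 0)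
    (g := fun n s => legCoeff α n * (s ^ (n + 1) / (n + 1)))
    (g' := fun n s => legCoeff α n * s ^ n)
    ((summable_geometric_of_lt_one (r := (3 / 4 : ℝ)) (by norm_num) (by norm_num)).mul_left K)
    Metric.isOpen_ball (convex_ball _ _).isPreconnected (fun n y _ => ?_)
    (fun n y hy => norm_legCoeff_mul_pow_le hb hK (mem_ball_zero_iff.1 hy).le n)
    (Metric.mem_ball_self (by norm_num)) ?_ (mem_ball_zero_iff.2 hs)
  · have h0 : (n : ℝ) + 1 ≠ 0 := by positivity
    refine (((hasDerivAt_pow (n + 1) y).div_const ((n : ℝ) + 1)).const_mul _).congr_deriv ?_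
    push_cast
    field_simp
  · exact summable_zero.congr fun n => by simp

lemma legSolInt_zero : legSolInt α 0 = 0 := by simp [legSolInt]

lemma legSol_zero : legSol α 0 = 1 := by
  refine (hasSum_legSol (α := α) (s := 0) (by norm_num)).unique ?_
  convert hasSum_single (f := fun n : ℕ => legCoeff α n * (0 : ℝ) ^ n) 0 ?_
  · simp [legCoeff]
  · intro k hk; simp [hk]

/-- The once integrated differential equation for `legSol`. -/
lemma mul_legSolDeriv (hs : |s| < 1 / 2) :
    s * (1 + s) * legSolDeriv α s = α * legSolInt α s := by
  have h0 := (summable_legSolDeriv (α := α) hs).hasSum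
  have h1 := h0.mul_left s
  have h2 := h0.mul_left (s * s)
  have h3 := (hasSum_nat_add_iff' 1).2 h1
  simp only [Finset.range_one, Finset.sum_singleton, CharP.cast_eq_zero, zero_mul, mul_zero,
    sub_zero] at h3
  have h4 := h3.add h2
  have h5 := (hasSum_legSolInt (α := α) hs).mul_left α
  have h6 : s * (1 + s) * legSolDeriv α s
      = s * legSolDeriv α s + s * s * legSolDeriv α s := by ring
  rw [h6]
  have e : ∀ n : ℕ, s * (legCoeff α (n + 1) * ((n + 1 : ℕ) * s ^ (n + 1 - 1)))
      + s * s * (legCoeff α n * (n * s ^ (n - 1)))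
      = α * (legCoeff α n * (s ^ (n + 1) / (n + 1))) := by
    intro n
    rcases n with _ | n
    · simp [legCoeff]
      ring
    · rw [legCoeff]
      push_cast
      have h7 : (n : ℝ) + 1 ≠ 0 := by positivity
      have h8 : (n : ℝ) + 1 + 1 ≠ 0 := by positivity
      field_simp
      ring
  simp only [e] at h4
  exact h4.unique h5

/-- Write `y` for the solution and `Y` for its primitive. The equation gives `(Y y)' = y² + s (1 +
s) y'² / α ≥ 0` for `α > 0`, so `Y y ≥ 0`; then `s (1 + s) y y' = α Y y ≥ 0`, so `y²` increases from
`1`. For `α = 0` one has `y' = 0`. -/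
lemma legSol_ne_zero_of_nonneg (hα : 0 ≤ α) (h0 : 0 ≤ s) (hs : s < 1 / 2) :
    legSol α s ≠ 0 := by
  have habs : ∀ y ∈ Set.Icc (0 : ℝ) s, |y| < 1 / 2 := fun y hy => by
    rw [abs_of_nonneg hy.1]; exact hy.2.trans_lt hs
  have hint : ∀ y ∈ interior (Set.Icc (0 : ℝ) s), y ∈ Set.Icc (0 : ℝ) s ∧ 0 < y := fun y hy => by
    rw [interior_Icc] at hy
    exact ⟨Set.Ioo_subset_Icc_self hy, hy.1⟩
  have hK : MonotoneOn (fun y => legSolInt α y * legSol α y) (Set.Icc 0 s) := by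
    have hd : ∀ y ∈ Set.Icc (0 : ℝ) s, HasDerivAt (fun y => legSolInt α y * legSol α y)
        (legSol α y * legSol α y + legSolInt α y * legSolDeriv α y) y := fun y hy =>
      (hasDerivAt_legSolInt (habs y hy)).mul (hasDerivAt_legSol (habs y hy))
    refine monotoneOn_of_deriv_nonneg (convex_Icc _ _)
      (fun y hy => (hd y hy).continuousAt.continuousWithinAt)
      (fun y hy => (hd y (hint y hy).1).differentiableAt.differentiableWithinAt) fun y hy => ?_
    obtain ⟨hy1, hy0⟩ := hint y hy
    rw [(hd y hy1).deriv]
    rcases hα.eq_or_lt with h | h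
    · have h1 := mul_legSolDeriv (α := α) (habs y hy1)
      rw [← h, zero_mul, mul_eq_zero] at h1
      have h2 : legSolDeriv 0 y = 0 := h1.resolve_left (by positivity)
      rw [← h, h2, mul_zero, add_zero]
      exact mul_self_nonneg _
    · have h1 := mul_legSolDeriv (α := α) (habs y hy1)
      have h2 : legSolInt α y * legSolDeriv α y = y * (1 + y) * legSolDeriv α y ^ 2 / α := by
        rw [eq_div_iff h.ne']
        linear_combination (-legSolDeriv α y) * h1
      rw [h2]
      have := mul_self_nonneg (legSol α y)
      positivity
  have hH : MonotoneOn (fun y => legSol α y * legSol α y) (Set.Icc 0 s) := by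
    have hd : ∀ y ∈ Set.Icc (0 : ℝ) s, HasDerivAt (fun y => legSol α y * legSol α y)
        (legSolDeriv α y * legSol α y + legSol α y * legSolDeriv α y) y := fun y hy =>
      (hasDerivAt_legSol (habs y hy)).mul (hasDerivAt_legSol (habs y hy))
    refine monotoneOn_of_deriv_nonneg (convex_Icc _ _)
      (fun y hy => (hd y hy).continuousAt.continuousWithinAt)
      (fun y hy => (hd y (hint y hy).1).differentiableAt.differentiableWithinAt) fun y hy => ?_
    obtain ⟨hy1, hy0⟩ := hint y hy
    rw [(hd y hy1).deriv]
    have h1 := mul_legSolDeriv (α := α) (habs y hy1)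
    have h2 := hK (Set.left_mem_Icc.2 h0) hy1 hy0.le
    simp only [legSolInt_zero, zero_mul] at h2
    have h3 : 0 < y * (1 + y) := by positivity
    have h4 : 0 ≤ y * (1 + y) * (legSolDeriv α y * legSol α y) := by
      have : y * (1 + y) * (legSolDeriv α y * legSol α y)
          = α * (legSolInt α y * legSol α y) := by
        linear_combination legSol α y * h1
      rw [this]; positivity
    have h5 := nonneg_of_mul_nonneg_right h4 h3
    linarith
  have h1 := hH (Set.left_mem_Icc.2 h0) (Set.right_mem_Icc.2 h0) h0
  intro h
  simp only [legSol_zero, h] at h1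
  norm_num at h1

/-- For `α ≤ 0` the series alternates, and from index `2` on its terms decrease in absolute value.
The first four terms therefore bound it below, and their sum is positive in this range, which covers
the relevant `α` and `s ≤ sinh² ½`. -/
lemma legSol_pos_of_neg (hα : -3.9 ≤ α) (hα0 : α ≤ 0) (h0 : 0 ≤ s) (hs : s ≤ 0.272) :
    0 < legSol α s := by
  have habs : |s| < 1 / 2 := by rw [abs_of_nonneg h0]; linarith
  set b : ℕ → ℝ := fun n => (-1) ^ n * (legCoeff α n * s ^ n) with hb
  have hrec : ∀ n, b (n + 1) = b n * (s * (n * (n + 1) - α) / ((n : ℝ) + 1) ^ 2) := fun n => by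
    simp only [hb, legCoeff, pow_succ]; ring
  have hb0 : ∀ n, 0 ≤ b n := by
    intro n
    induction n with
    | zero => simp [hb, legCoeff]
    | succ n ih =>
      rw [hrec]
      have : (0 : ℝ) ≤ n * (n + 1) - α := by
        have : (0 : ℝ) ≤ n * (n + 1) := by positivity
        linarith
      positivity
  have hanti : Antitone fun k => b (k + 2) := by
    refine antitone_nat_of_succ_le fun k => ?_
    rw [show k + 1 + 2 = (k + 2) + 1 by ring, hrec]
    refine mul_le_of_le_one_right (hb0 _) ?_
    rw [div_le_one (by positivity)]
    push_cast
    have hk : (0 : ℝ) ≤ k := k.cast_nonneg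
    have h1 : (0 : ℝ) ≤ (k + 2) * (k + 2 + 1) - α := by nlinarith
    nlinarith
  have hsum := (hasSum_nat_add_iff' 2).2 (hasSum_legSol (α := α) habs)
  have hterm : ∀ k, legCoeff α (k + 2) * s ^ (k + 2) = (-1) ^ k * b (k + 2) := fun k => by
    simp only [hb, ← mul_assoc, ← pow_add]
    rw [show k + (k + 2) = 2 * (k + 1) by ring, pow_mul]; norm_num
  simp only [hterm] at hsum
  -- The terms of index `2` and `3` bound the tail from below. The first two terms are kept apart
  -- because `|α| s` may exceed `1`.
  have hle := hanti.alternating_series_le_tendsto hsum.tendsto_sum_nat 1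
  simp only [Finset.sum_range_succ, Finset.sum_range_zero, hb, legCoeff] at hle
  norm_num at hle
  set t := -α * s with ht
  have ht0 : 0 ≤ t := mul_nonneg (neg_nonneg.2 hα0) h0
  have ht1 : t ≤ 1.061 := by nlinarith
  have h1 : (6 - α) * s ≤ 2.7 := by nlinarith
  have h2 : 0 ≤ t * (t + 2 * s) := by positivity
  have h3 : t * (t + 2 * s) * ((6 - α) * s) ≤ t * (t + 2 * s) * 2.7 :=
    mul_le_mul_of_nonneg_left h1 h2
  have h4 : α * ((α - 2) / 4) * s ^ 2 + α * ((α - 2) / 4) * ((α - 6) / 9) * s ^ 3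
      = t * (t + 2 * s) / 4 - t * (t + 2 * s) * ((6 - α) * s) / 36 := by
    rw [ht]; ring
  have h5 : α * s = -t := by rw [ht]; ring
  rw [h4, h5] at hle
  nlinarith [mul_nonneg ht0 h0]

end Real

/-! ### Identification with the Legendre function at `cosh 1` -/

/-- The Pochhammer factors combine through `(-ν + n)(ν + 1 + n) = n (n + 1) - α`, so only the real
number `ν (ν + 1) = α` enters. The sign is absorbed by passing from `(1 - z) / 2` to `(z - 1) / 2`.
-/
lemma hypergeometric_coeff_eq {α : ℝ} {ν : ℂ} (hν : ν * (ν + 1) = α) (n : ℕ) :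
    ((n.factorial : ℂ)⁻¹ * (ascPochhammer ℂ n).eval (-ν) * (ascPochhammer ℂ n).eval (ν + 1) *
      ((ascPochhammer ℂ n).eval 1)⁻¹) = (-1) ^ n * legCoeff α n := by
  rw [ascPochhammer_eval_one]
  induction n with
  | zero => simp [legCoeff]
  | succ n ih =>
    have hf : (n.factorial : ℂ) ≠ 0 := by exact_mod_cast n.factorial_ne_zero
    have hn : (n : ℂ) + 1 ≠ 0 := by exact_mod_cast n.succ_ne_zero
    rw [ascPochhammer_succ_eval, ascPochhammer_succ_eval, legCoeff, Nat.factorial_succ]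
    push_cast
    have e : ((α : ℂ) - n * (n + 1)) = -((-ν + n) * (ν + 1 + n)) := by
      rw [← hν]; ring
    rw [e]
    have h2 : (-1 : ℂ) ^ (n + 1) * (legCoeff α n * (-((-ν + n) * (ν + 1 + n)) / (n + 1) ^ 2))
        = ((-1) ^ n * legCoeff α n) * (((-ν + n) * (ν + 1 + n)) / (n + 1) ^ 2) := by ring
    rw [h2, ← ih]
    field_simp

lemma legendreP_eq_tsum {α : ℝ} {ν : ℂ} (hν : ν * (ν + 1) = α) (z : ℂ) :
    legendreP ν z = ∑' n : ℕ, (legCoeff α n : ℂ) * ((z - 1) / 2) ^ n := by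
  rw [legendreP, ordinaryHypergeometric_eq_tsum]
  refine tsum_congr fun n => ?_
  rw [hypergeometric_coeff_eq hν, smul_eq_mul,
    show (1 - z) / 2 = (-1) * ((z - 1) / 2) by ring, mul_pow]
  have : ((-1 : ℂ) ^ n) * (-1) ^ n = 1 := by rw [← mul_pow]; norm_num
  linear_combination ((legCoeff α n : ℂ) * ((z - 1) / 2) ^ n) * this

/-- The point `(cosh 1 - 1) / 2 = sinh² ½`. -/
def sOne : ℝ := Real.sinh (1 / 2) ^ 2

lemma sOne_pos : 0 < sOne := pow_pos sinh_half_pos 2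

lemma cosh_half_sq : Real.cosh (1 / 2) ^ 2 = 1 + sOne := by
  rw [sOne, Real.cosh_sq]; ring

lemma cosh_one_eq : Real.cosh 1 = 1 + 2 * sOne := by
  have h := Real.cosh_two_mul (1 / 2)
  rw [cosh_half_sq, show (2 : ℝ) * (1 / 2) = 1 by norm_num] at h
  rw [h, sOne]; ring

lemma sOne_eq : sOne = (Real.exp 1 + (Real.exp 1)⁻¹ - 2) / 4 := by
  have h := cosh_one_eq
  rw [Real.cosh_eq, Real.exp_neg] at h
  linarith

lemma sOne_bounds : 0.2715403173 < sOne ∧ sOne < 0.2715403176 := by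
  have h1 := Real.exp_one_gt_d9
  have h2 := Real.exp_one_lt_d9
  have h3 : (2.7182818286 : ℝ)⁻¹ < (Real.exp 1)⁻¹ := inv_strictAnti₀ (Real.exp_pos 1) h2
  have h4 : (Real.exp 1)⁻¹ < (2.7182818283 : ℝ)⁻¹ := inv_strictAnti₀ (by norm_num) h1
  rw [sOne_eq]
  norm_num at h3 h4 ⊢
  constructor <;> linarith

lemma abs_sOne_lt : |sOne| < 1 / 2 := by
  rw [abs_of_pos sOne_pos]; linarith [sOne_bounds.2]

section Complex

variable {α : ℝ} {ν : ℂ}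

lemma cosh_one_sub_one_div_two : (Complex.cosh 1 - 1) / 2 = (sOne : ℂ) := by
  have h : Complex.cosh 1 = ((1 + 2 * sOne : ℝ) : ℂ) := by
    rw [← cosh_one_eq]; simp
  rw [h]; push_cast; ring

lemma legendreP_cosh_one (hν : ν * (ν + 1) = α) :
    legendreP ν (Complex.cosh 1) = legSol α sOne := by
  rw [legendreP_eq_tsum hν, cosh_one_sub_one_div_two, legSol, Complex.ofReal_tsum]
  push_cast; rfl

lemma deriv_legendreP_cosh_one (hν : ν * (ν + 1) = α) :
    deriv (legendreP ν) (Complex.cosh 1) = ((legSolDeriv α sOne / 2 : ℝ) : ℂ) := by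
  obtain ⟨K, hK, hb⟩ := exists_legCoeff_bound α
  have hd := hasDerivAt_tsum_mul_pow (𝕜 := ℂ) (a := fun n => (legCoeff α n : ℂ)) (K := K)
    (fun n => by rw [Complex.norm_real]; exact hb n) hK (z := (sOne : ℂ))
    (by rw [Complex.norm_real]; exact abs_sOne_lt)
  have hlin : HasDerivAt (fun z : ℂ => (z - 1) / 2) (1 / 2) (Complex.cosh 1) :=
    ((hasDerivAt_id _).sub_const 1).div_const 2
  rw [← cosh_one_sub_one_div_two] at hd
  have hc := hd.comp (Complex.cosh 1) hlin
  have e : legendreP ν = (fun z => ∑' n : ℕ, (legCoeff α n : ℂ) * z ^ n) ∘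
      fun z : ℂ => (z - 1) / 2 := funext fun z => legendreP_eq_tsum hν z
  rw [e, hc.deriv, cosh_one_sub_one_div_two, legSolDeriv, Complex.ofReal_div, Complex.ofReal_tsum]
  push_cast; ring

end Complex

/-! ### The case `β = coth ½`: Legendre's equation and zero capacity -/

/-- The value of `I(α, κ)`, `κ` being the endpoint `coth ½`. -/
def minKappa (α : ℝ) : ℝ := (1 + sOne) * legSolDeriv α sOne / legSol α sOne

lemma legTerm_eq {α : ℝ} {μ : ℂ} (hμ : μ ^ 2 = (α + 1 / 4 : ℝ)) : legTerm μ = minKappa α := by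
  have hν : (-1 / 2 + μ) * (-1 / 2 + μ + 1) = (α : ℂ) := by
    have : (-1 / 2 + μ) * (-1 / 2 + μ + 1) = μ ^ 2 - 1 / 4 := by ring
    rw [this, hμ]; push_cast; ring
  rw [legTerm, legendreP_cosh_one hν, deriv_legendreP_cosh_one hν, minKappa]
  have h : (Real.exp 1 + 1) ^ 2 / (2 * Real.exp 1) = 2 * (1 + sOne) := by
    rw [sOne_eq]
    have := (Real.exp_pos 1).ne'
    field_simp
    ring
  rw [h]
  push_cast
  ring

lemma legSol_ne_zero {α s : ℝ} (hα : -3.9 ≤ α) (h0 : 0 ≤ s) (hs : s ≤ sOne) :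
    legSol α s ≠ 0 := by
  have := sOne_bounds.2
  rcases le_total 0 α with h | h
  · exact legSol_ne_zero_of_nonneg h h0 (by linarith)
  · exact (legSol_pos_of_neg hα h h0 (by linarith)).ne'

/-- The regular solution of the Euler-Lagrange equation for `β = coth ½`, through its flux and
its logarithmic derivative. -/
lemma exists_minimizer_kappa {α : ℝ} (hα : -3.9 ≤ α) :
    ∃ q r h : ℝ → ℝ, q 1 - q 0 = minKappa α ∧
      (∀ x ∈ Set.Icc (0 : ℝ) 1,
        HasDerivAt q (α * weight kappa x - weight kappa x * r x ^ 2) x) ∧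
      (∀ x ∈ Set.Icc (0 : ℝ) 1, q x = weight kappa x * r x) ∧
      ContinuousOn r (Set.Icc 0 1) ∧ h 1 = 1 ∧
      ∀ x ∈ Set.Icc (0 : ℝ) 1, HasDerivAt h (r x * h x) x := by
  -- With `s = sinh² (x/2) = (cosh x - 1) / 2` the equation `(sinh x · u')' = α sinh x · u` becomes
  -- `(s (1 + s) y')' = α y`.
  set σ : ℝ → ℝ := fun x => Real.sinh (x / 2) ^ 2 with hσ
  have dσ : ∀ x, HasDerivAt σ (Real.sinh (x / 2) * Real.cosh (x / 2)) x := fun x => by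
    refine ((((hasDerivAt_id x).div_const 2).sinh).pow 2).congr_deriv ?_
    simp; ring
  have hsinh : ∀ x, Real.sinh x = 2 * (Real.sinh (x / 2) * Real.cosh (x / 2)) := fun x => by
    rw [← mul_assoc, ← Real.sinh_two_mul]; congr 1; ring
  have hσ0 : ∀ x, 0 ≤ σ x := fun x => sq_nonneg _
  have hσ1 : ∀ x ∈ Set.Icc (0 : ℝ) 1, σ x ≤ sOne := fun x hx => by
    have h1 : Real.sinh (x / 2) ≤ Real.sinh (1 / 2) :=
      Real.sinh_le_sinh.2 (by linarith [hx.2])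
    have h2 : 0 ≤ Real.sinh (x / 2) := Real.sinh_nonneg_iff.2 (by linarith [hx.1])
    exact pow_le_pow_left₀ h2 h1 2
  have habs : ∀ x ∈ Set.Icc (0 : ℝ) 1, |σ x| < 1 / 2 := fun x hx => by
    rw [abs_of_nonneg (hσ0 x)]
    linarith [hσ1 x hx, sOne_bounds.2]
  have hne : ∀ x ∈ Set.Icc (0 : ℝ) 1, legSol α (σ x) ≠ 0 := fun x hx =>
    legSol_ne_zero hα (hσ0 x) (hσ1 x hx)
  have dH : ∀ x ∈ Set.Icc (0 : ℝ) 1, HasDerivAt (fun x => legSol α (σ x))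
      (legSolDeriv α (σ x) * (Real.sinh (x / 2) * Real.cosh (x / 2))) x := fun x hx =>
    (hasDerivAt_legSol (habs x hx)).comp x (dσ x)
  have dJ : ∀ x ∈ Set.Icc (0 : ℝ) 1, HasDerivAt (fun x => legSolInt α (σ x))
      (legSol α (σ x) * (Real.sinh (x / 2) * Real.cosh (x / 2))) x := fun x hx =>
    (hasDerivAt_legSolInt (habs x hx)).comp x (dσ x)
  have ode : ∀ x ∈ Set.Icc (0 : ℝ) 1,
      (Real.sinh (x / 2) * Real.cosh (x / 2)) ^ 2 * legSolDeriv α (σ x)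
        = α * legSolInt α (σ x) := fun x hx => by
    rw [← mul_legSolDeriv (habs x hx), mul_pow, Real.cosh_sq (x / 2)]
    simp only [hσ]; ring
  have hs1 : σ 1 = sOne := rfl
  have hs0 : σ 0 = 0 := by simp [hσ]
  set r : ℝ → ℝ := fun x =>
    legSolDeriv α (σ x) * (Real.sinh (x / 2) * Real.cosh (x / 2)) / legSol α (σ x) with hr
  -- By the integrated equation this equals `weight kappa x * r x`. Written through the primitive,
  -- it can be differentiated without second derivatives of `legSol`.
  set q : ℝ → ℝ := fun x => α / sOne * (legSolInt α (σ x) / legSol α (σ x)) with hq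
  have hw : ∀ x, weight kappa x = Real.sinh (x / 2) * Real.cosh (x / 2) / sOne := fun x => by
    rw [weight_kappa, hsinh, ← sOne]
    have := sOne_pos.ne'
    field_simp
  have hsp := sOne_pos.ne'
  refine ⟨q, r, fun x => legSol α (σ x) / legSol α sOne, ?_, ?_, ?_, ?_, ?_, ?_⟩
  · have h1 := mul_legSolDeriv (α := α) abs_sOne_lt
    have h2 := hne 1 (by simp)
    rw [hs1] at h2
    simp only [hq, hs1, hs0, legSolInt_zero, minKappa, zero_div, mul_zero, sub_zero]
    field_simp
    linear_combination -h1
  · intro x hx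
    have h2 := hne x hx
    refine (((dJ x hx).div (dH x hx) h2).const_mul (α / sOne)).congr_deriv ?_
    simp only [hr, hw]
    field_simp
    linear_combination (Real.sinh (x / 2) * legSolDeriv α (σ x)) * ode x hx
  · intro x hx
    have h2 := hne x hx
    simp only [hq, hr, hw]
    field_simp
    linear_combination -ode x hx
  · have hmaps : Set.MapsTo σ (Set.Icc 0 1) (Set.Icc (-(1 / 2)) (1 / 2)) := fun x hx =>
      abs_le.1 (habs x hx).le
    refine ContinuousOn.div ?_ (fun x hx => (dH x hx).continuousAt.continuousWithinAt) hne
    refine (continuousOn_legSolDeriv.comp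
      (fun x _ => (dσ x).continuousAt.continuousWithinAt) hmaps).mul ?_
    fun_prop
  · simp only [hs1]
    exact div_self (hs1 ▸ hne 1 (by simp))
  · intro x hx
    have h2 := hne x hx
    refine ((dH x hx).div_const _).congr_deriv ?_
    simp only [hr]
    field_simp

lemma energyGE_minKappa {α : ℝ} (hα : -3.9 ≤ α) : EnergyGE α kappa (minKappa α) := by
  obtain ⟨q, r, h, hmin, hq, hqr, hr, -⟩ := exists_minimizer_kappa hα
  rw [← hmin]
  exact energyGE_of_riccati (fun x hx => weight_kappa_nonneg hx.1) hq hqr hr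

lemma weight_kappa_le {x : ℝ} (hx : x ∈ Set.Icc (0 : ℝ) 1) : weight kappa x ≤ 4 * x := by
  have h1 : Real.sinh x ≤ 2 * x := by
    have hcosh : Real.cosh 1 ≤ 2 := by rw [cosh_one_eq]; linarith [sOne_bounds.2]
    have hm : MonotoneOn (fun y => 2 * y - Real.sinh y) (Set.Icc 0 1) := by
      have hd : ∀ y, HasDerivAt (fun y => 2 * y - Real.sinh y) (2 * 1 - Real.cosh y) y := fun y =>
        ((hasDerivAt_id y).const_mul 2).sub (Real.hasDerivAt_sinh y)
      refine monotoneOn_of_deriv_nonneg (convex_Icc _ _) (by fun_prop)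
        (fun y _ => (hd y).differentiableAt.differentiableWithinAt) fun y hy => ?_
      rw [interior_Icc] at hy
      rw [(hd y).deriv]
      have : Real.cosh y ≤ Real.cosh 1 := Real.cosh_le_cosh.2 (by
        rw [abs_of_pos hy.1, abs_one]; exact hy.2.le)
      linarith
    have := hm (Set.left_mem_Icc.2 zero_le_one) hx hx.1
    simp only [mul_zero, Real.sinh_zero, sub_zero] at this
    linarith
  rw [weight_kappa, ← sOne, div_le_iff₀ (by linarith [sOne_pos])]
  nlinarith [sOne_bounds.1, hx.1]

lemma integral_inv_add {ε : ℝ} (hε : 0 < ε) :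
    ∫ x in (0 : ℝ)..1, 1 / (x + ε) = Real.log ((1 + ε) / ε) := by
  have hd : ∀ x ∈ Set.uIcc (0 : ℝ) 1, HasDerivAt (fun x => Real.log (x + ε)) (1 / (x + ε)) x := by
    intro x hx
    rw [Set.uIcc_of_le zero_le_one] at hx
    exact ((hasDerivAt_id x).add_const ε).log (by simp only [id]; linarith [hx.1])
  rw [intervalIntegral.integral_eq_sub_of_hasDerivAt hd, zero_add,
    Real.log_div (by linarith) hε.ne']
  apply ContinuousOn.intervalIntegrable
  rw [Set.uIcc_of_le zero_le_one]
  exact continuousOn_const.div (by fun_prop) fun x hx => by linarith [hx.1]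

/-- The cutoff `χ = (log (1 + ε) - log (x + ε)) / Λ` has small energy for a weight of order `x`:
after integration this bound contributes `O(1/Λ)`. -/
lemma mul_cutoffDeriv_sq_le {ε Λ x : ℝ} (hε : 0 < ε) (hx : 0 ≤ x) :
    x * (-(1 / (x + ε)) / Λ) ^ 2 ≤ 1 / Λ ^ 2 * (1 / (x + ε)) := by
  have hxε : 0 < x + ε := by linarith
  have h1 : x / (x + ε) ≤ 1 := by rw [div_le_one hxε]; linarith
  have h2 : x * (-(1 / (x + ε)) / Λ) ^ 2 = (1 / Λ ^ 2 * (1 / (x + ε))) * (x / (x + ε)) := by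
    rw [div_pow, neg_sq]; field_simp
  rw [h2]
  exact mul_le_of_le_one_right (by positivity) h1

lemma mul_cutoff_sq_le {ε Λ x : ℝ} (hε : 0 < ε) (hx : x ∈ Set.Icc (0 : ℝ) 1) :
    x * ((Real.log (1 + ε) - Real.log (x + ε)) / Λ) ^ 2 ≤ 8 / Λ ^ 2 := by
  have hx0 := hx.1
  have hxε : 0 < x + ε := by linarith
  set y := (1 + ε) / (x + ε) with hy
  have hy1 : 1 ≤ y := by rw [hy, le_div_iff₀ hxε]; linarith [hx.2]
  have hlogy : Real.log (1 + ε) - Real.log (x + ε) = Real.log y := by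
    rw [hy, Real.log_div (by linarith) hxε.ne']
  have hly0 : 0 ≤ Real.log y := Real.log_nonneg hy1
  have hly : Real.log y ^ 2 ≤ 4 * y := by
    have h2 : Real.log (Real.sqrt y) ≤ Real.sqrt y - 1 :=
      Real.log_le_sub_one_of_pos (Real.sqrt_pos.2 (by linarith))
    rw [Real.log_sqrt (by linarith)] at h2
    have h3 : Real.log y ≤ 2 * Real.sqrt y := by linarith
    calc Real.log y ^ 2 ≤ (2 * Real.sqrt y) ^ 2 := pow_le_pow_left₀ hly0 h3 2
      _ = 4 * y := by rw [mul_pow, Real.sq_sqrt (by linarith)]; norm_num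
  have hxy : x * y ≤ 2 := by
    rw [hy, mul_div_assoc', div_le_iff₀ hxε]; nlinarith [hx.2]
  rw [hlogy, div_pow, mul_div_assoc']
  gcongr
  nlinarith

/-- The point `0` has zero capacity for the weight at `β = coth ½`: the boundary condition there
costs nothing. -/
lemma energyGE_kappa_iff {α t : ℝ} (hα : -3.9 ≤ α) : EnergyGE α kappa t ↔ t ≤ minKappa α := by
  refine ⟨fun hE => ?_, (energyGE_minKappa hα).mono⟩
  obtain ⟨q, r, h, hmin, hq, hqr, hr, h1, dh⟩ := exists_minimizer_kappa hα
  have hh : ContinuousOn h (Set.Icc 0 1) :=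
    fun x hx => (dh x hx).continuousAt.continuousWithinAt
  obtain ⟨R, hR⟩ := isCompact_Icc.exists_bound_of_continuousOn hr
  set c := 1 - h 0 with hc
  set A : ℝ := c ^ 2 * (8 + 64 * R ^ 2) with hA
  have hA0 : 0 ≤ A := by positivity
  have key : ∀ Λ : ℝ, 1 ≤ Λ → t ≤ minKappa α + A / Λ := by
    intro Λ hΛ
    -- Chosen so that `∫₀¹ dx / (x + ε) = log ((1 + ε) / ε)` is exactly `Λ`, whence `χ 0 = 1`.
    set ε : ℝ := 1 / (Real.exp Λ - 1) with hε
    have hexp : 2 ≤ Real.exp Λ := by linarith [Real.add_one_le_exp Λ]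
    have hε0 : 0 < ε := by rw [hε]; apply one_div_pos.2; linarith
    have hε1 : ε ≤ 1 := by
      rw [hε, div_le_one (by linarith)]; linarith
    have hlog : Real.log ((1 + ε) / ε) = Λ := by
      have : (1 + ε) / ε = Real.exp Λ := by
        have : Real.exp Λ - 1 ≠ 0 := by linarith
        rw [hε]; field_simp; ring
      rw [this, Real.log_exp]
    have hΛ0 : 0 < Λ := by linarith
    set χ : ℝ → ℝ := fun x => (Real.log (1 + ε) - Real.log (x + ε)) / Λ with hχ
    set χ' : ℝ → ℝ := fun x => -(1 / (x + ε)) / Λ with hχ'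
    have dχ : ∀ x ∈ Set.Icc (0 : ℝ) 1, HasDerivAt χ (χ' x) x := fun x hx =>
      ((((hasDerivAt_id x).add_const ε).log
        (by simp only [id]; linarith [hx.1])).const_sub _).div_const Λ
    have hχc : ContinuousOn χ (Set.Icc 0 1) :=
      fun x hx => (dχ x hx).continuousAt.continuousWithinAt
    have hχ'c : ContinuousOn χ' (Set.Icc 0 1) :=
      (ContinuousOn.neg (continuousOn_const.div (by fun_prop)
        fun x hx => by linarith [hx.1])).div_const Λ
    have hχ0 : χ 0 = 1 := by
      simp only [hχ, zero_add]
      rw [← Real.log_div (by linarith) hε0.ne', hlog, div_self hΛ0.ne']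
    have hχ1 : χ 1 = 0 := by simp [hχ]
    -- The regular solution `h` need not be `1` at `0`; the cutoff corrects its value there at a
    -- cost of at most `A / Λ`.
    set u : ℝ → ℝ := fun x => h x + c * χ x with hu
    set g : ℝ → ℝ := fun x => r x * h x + c * χ' x with hg
    have hH : IsH1 u g := isH1_of_hasDerivAt
      (fun x hx => (dh x hx).add ((dχ x hx).const_mul c))
      ((hr.mul hh).add (continuousOn_const.mul hχ'c))
    have hu0 : u 0 = 1 := by simp only [hu, hχ0, hc]; ring
    have hu1 : u 1 = 1 := by simp only [hu, hχ1, h1]; ring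
    have hle := hE u g hH hu0 hu1
    rw [hH.energy_eq_riccati hq hqr hr, hu0, hu1] at hle
    have hint : ∫ x in (0 : ℝ)..1, weight kappa x * (g x - r x * u x) ^ 2 ≤
        ∫ x in (0 : ℝ)..1, (8 * c ^ 2 / Λ ^ 2 * (1 / (x + ε)) + 64 * R ^ 2 * c ^ 2 / Λ ^ 2) := by
      have hrhs : ContinuousOn (fun x : ℝ => 1 / (x + ε)) (Set.uIcc 0 1) := by
        rw [Set.uIcc_of_le zero_le_one]
        exact continuousOn_const.div (by fun_prop) fun x hx => by linarith [hx.1]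
      refine intervalIntegral.integral_mono_on zero_le_one ?_ ?_ fun x hx => ?_
      · apply ContinuousOn.intervalIntegrable
        rw [Set.uIcc_of_le zero_le_one]
        exact (continuous_weight _).continuousOn.mul
          ((((hr.mul hh).add (continuousOn_const.mul hχ'c)).sub
            (hr.mul (hh.add (continuousOn_const.mul hχc)))).pow 2)
      · exact ((continuousOn_const.mul hrhs).intervalIntegrable).add intervalIntegrable_const
      · have hx0 := hx.1
        have e1 : g x - r x * u x = c * (χ' x - r x * χ x) := by
          simp only [hg, hu]; ring
        have hwx := weight_kappa_le hx
        have hw0 := weight_kappa_nonneg hx0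
        have hr2 : r x ^ 2 ≤ R ^ 2 := by
          have := hR x hx
          rw [Real.norm_eq_abs] at this
          rw [← sq_abs]
          exact pow_le_pow_left₀ (abs_nonneg _) this 2
        have hsq : (χ' x - r x * χ x) ^ 2 ≤ 2 * χ' x ^ 2 + 2 * (R ^ 2 * χ x ^ 2) := by
          have := mul_le_mul_of_nonneg_right hr2 (sq_nonneg (χ x))
          nlinarith [sq_nonneg (χ' x + r x * χ x)]
        have hA1 : x * χ' x ^ 2 ≤ 1 / Λ ^ 2 * (1 / (x + ε)) := mul_cutoffDeriv_sq_le hε0 hx0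
        have hA2 : x * χ x ^ 2 ≤ 8 / Λ ^ 2 := mul_cutoff_sq_le hε0 hx
        rw [e1, mul_pow]
        calc weight kappa x * (c ^ 2 * (χ' x - r x * χ x) ^ 2)
            ≤ (4 * x) * (c ^ 2 * (2 * χ' x ^ 2 + 2 * (R ^ 2 * χ x ^ 2))) := by gcongr
          _ = 8 * c ^ 2 * (x * χ' x ^ 2) + 8 * R ^ 2 * c ^ 2 * (x * χ x ^ 2) := by ring
          _ ≤ 8 * c ^ 2 * (1 / Λ ^ 2 * (1 / (x + ε))) + 8 * R ^ 2 * c ^ 2 * (8 / Λ ^ 2) := by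
            gcongr
          _ = _ := by ring
    have hval : ∫ x in (0 : ℝ)..1, (8 * c ^ 2 / Λ ^ 2 * (1 / (x + ε)) + 64 * R ^ 2 * c ^ 2 / Λ ^ 2)
        = 8 * c ^ 2 / Λ ^ 2 * Λ + 64 * R ^ 2 * c ^ 2 / Λ ^ 2 := by
      rw [intervalIntegral.integral_add, intervalIntegral.integral_const_mul, integral_inv_add hε0,
        hlog]
      · simp
      · apply ContinuousOn.intervalIntegrable
        rw [Set.uIcc_of_le zero_le_one]
        exact continuousOn_const.mul
          (continuousOn_const.div (by fun_prop) fun x hx => by linarith [hx.1])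
      · exact intervalIntegrable_const
    have hfin : 8 * c ^ 2 / Λ ^ 2 * Λ + 64 * R ^ 2 * c ^ 2 / Λ ^ 2 ≤ A / Λ := by
      have e4 : A / Λ - (8 * c ^ 2 / Λ ^ 2 * Λ + 64 * R ^ 2 * c ^ 2 / Λ ^ 2)
          = 64 * R ^ 2 * c ^ 2 * (Λ - 1) / Λ ^ 2 := by
        rw [hA]; field_simp; ring
      have : 0 ≤ 64 * R ^ 2 * c ^ 2 * (Λ - 1) / Λ ^ 2 := by
        have : 0 ≤ Λ - 1 := by linarith
        positivity
      linarith
    rw [hval] at hint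
    simp only [one_pow, mul_one, hmin] at hle
    linarith
  refine le_of_forall_pos_le_add fun δ hδ => ?_
  have h2 := key (max 1 (A / δ)) (le_max_left _ _)
  have h3 : A / max 1 (A / δ) ≤ δ := by
    rw [div_le_iff₀ (by positivity)]
    have := le_max_right 1 (A / δ)
    rw [div_le_iff₀ hδ] at this
    linarith
  linarith

/-! ### Numerical location of the constants -/

/-- Tail estimate for a series whose terms eventually decay geometrically. -/
lemma abs_sub_sum_range_le {f : ℕ → ℝ} {a ρ : ℝ} (hf : HasSum f a) (hρ0 : 0 ≤ ρ) (hρ1 : ρ < 1)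
    {N : ℕ} (h : ∀ n, N ≤ n → |f (n + 1)| ≤ |f n| * ρ) :
    |a - ∑ n ∈ Finset.range N, f n| ≤ |f N| / (1 - ρ) := by
  have hb : ∀ n, ‖f (n + N)‖ ≤ |f N| * ρ ^ n := by
    intro n
    induction n with
    | zero => simp
    | succ n ih =>
      rw [show n + 1 + N = n + N + 1 by ring, Real.norm_eq_abs]
      refine (h (n + N) (Nat.le_add_left _ _)).trans ?_
      rw [pow_succ, ← mul_assoc]
      exact mul_le_mul_of_nonneg_right ih hρ0
  have h1 := (hasSum_nat_add_iff' N).2 hf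
  have h2 := tsum_of_norm_bounded ((hasSum_geometric_of_lt_one hρ0 hρ1).mul_left |f N|) hb
  rw [h1.tsum_eq, Real.norm_eq_abs] at h2
  rwa [div_eq_mul_inv]

/-- For `n ≥ N ≥ |α| - 1` one has `|α - n (n + 1)| ≤ (n + 1)²`, so the coefficients no longer grow
and the tail is geometric with ratio `s`. -/
lemma abs_legSol_sub_le {α s : ℝ} {N : ℕ} (hN : |α| ≤ N + 1) (h0 : 0 ≤ s) (hs : s < 1 / 2) :
    |legSol α s - ∑ n ∈ Finset.range N, legCoeff α n * s ^ n|
        ≤ |legCoeff α N| * s ^ N / (1 - s) ∧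
      |legSolInt α s - ∑ n ∈ Finset.range N, legCoeff α n * (s ^ (n + 1) / (n + 1))|
        ≤ |legCoeff α N| * s ^ N / (1 - s) := by
  have habs : |s| < 1 / 2 := by rwa [abs_of_nonneg h0]
  have hstep : ∀ n, N ≤ n → |legCoeff α (n + 1)| ≤ |legCoeff α n| := by
    intro n hn
    have hn' : (N : ℝ) ≤ n := by exact_mod_cast hn
    rw [legCoeff, abs_mul]
    refine mul_le_of_le_one_right (abs_nonneg _) ?_
    rw [abs_div, abs_of_pos (by positivity : (0 : ℝ) < ((n : ℝ) + 1) ^ 2),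
      div_le_one (by positivity)]
    have h3 := abs_le.1 hN
    have h4 : (0 : ℝ) ≤ n := n.cast_nonneg
    rw [abs_le]; constructor <;> nlinarith
  constructor
  · refine (abs_sub_sum_range_le (hasSum_legSol habs) h0 (by linarith) fun n hn => ?_).trans_eq ?_
    · rw [abs_mul, abs_mul, abs_pow, abs_pow, abs_of_nonneg h0, pow_succ, mul_assoc]
      exact mul_le_mul_of_nonneg_right (hstep n hn) (by positivity)
    · rw [abs_mul, abs_pow, abs_of_nonneg h0]
  · refine (abs_sub_sum_range_le (hasSum_legSolInt habs) h0 (by linarith) fun n hn => ?_).trans ?_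
    · have h1 : s ^ (n + 1 + 1) / ((n + 1 : ℕ) + 1 : ℝ) ≤ s ^ (n + 1) / (n + 1) * s := by
        rw [pow_succ, mul_div_right_comm]
        gcongr
        linarith
      rw [abs_mul, abs_mul, abs_of_nonneg (by positivity : 0 ≤ s ^ (n + 1 + 1) / ((n + 1 : ℕ) + 1 : ℝ)),
        abs_of_nonneg (by positivity : 0 ≤ s ^ (n + 1) / ((n : ℝ) + 1)), mul_assoc]
      exact mul_le_mul (hstep n hn) h1 (by positivity) (abs_nonneg _)
    · rw [abs_mul, abs_of_nonneg (by positivity : 0 ≤ s ^ (N + 1) / ((N : ℝ) + 1))]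
      have : s ^ (N + 1) / ((N : ℝ) + 1) ≤ s ^ N := by
        rw [div_le_iff₀ (by positivity), pow_succ]
        exact mul_le_mul_of_nonneg_left (by linarith [(N.cast_nonneg : (0 : ℝ) ≤ N)]) (by positivity)
      have h1s : 0 < 1 - s := by linarith
      gcongr

lemma kappa_sq : kappa ^ 2 = (1 + sOne) / sOne := by
  rw [kappa_eq, div_pow, cosh_half_sq, sOne]

/-- Here `κ² = (1 + s) / s` with `s = sinh² ½`. The integrated equation trades the derivative of the
solution for its primitive, and clearing the positive denominator leaves an expression linear in two
series. -/
lemma mem_admissible_kappa_iff {α : ℝ} (hα : -3.9 ≤ α) (hH : 0 < legSol α sOne) :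
    α ∈ admissible kappa ↔
      0 ≤ (1 + sOne - α * sOne) * legSol α sOne + α * legSolInt α sOne := by
  rw [mem_admissible, energyGE_kappa_iff hα, ← sub_nonneg]
  have hs := sOne_pos
  have h1 := mul_legSolDeriv (α := α) abs_sOne_lt
  have e : minKappa α - (α - kappa ^ 2) =
      ((1 + sOne - α * sOne) * legSol α sOne + α * legSolInt α sOne) / (sOne * legSol α sOne) := by
    rw [kappa_sq, minKappa, ← h1]
    field_simp
    ring
  rw [e, le_div_iff₀ (by positivity), zero_mul]

lemma sOne_pow_bounds :
    (0.27154031 < sOne ∧ sOne < 0.27154032) ∧ (0.07373414 < sOne ^ 2 ∧ sOne ^ 2 < 0.07373415) ∧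
    (0.02002179 < sOne ^ 3 ∧ sOne ^ 3 < 0.02002180) ∧
    (0.00543672 < sOne ^ 4 ∧ sOne ^ 4 < 0.00543673) ∧
    (0.00147628 < sOne ^ 5 ∧ sOne ^ 5 < 0.00147629) ∧
    (0.00040087 < sOne ^ 6 ∧ sOne ^ 6 < 0.00040088) ∧
    (0.00010885 < sOne ^ 7 ∧ sOne ^ 7 < 0.00010886) ∧
    (0.00002955 < sOne ^ 8 ∧ sOne ^ 8 < 0.00002956) ∧
    (0.00000802 < sOne ^ 9 ∧ sOne ^ 9 < 0.00000803) ∧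
    (0.00000217 < sOne ^ 10 ∧ sOne ^ 10 < 0.00000218) ∧
    (0.00000059 < sOne ^ 11 ∧ sOne ^ 11 < 0.00000060) := by
  obtain ⟨h1, h2⟩ := sOne_bounds
  have lo : ∀ {k : ℕ} {c : ℝ}, c < 0.2715403173 ^ k → c < sOne ^ k := fun hc =>
    hc.trans_le (pow_le_pow_left₀ (by norm_num) h1.le _)
  have hi : ∀ {k : ℕ} {c : ℝ}, (0.2715403176 : ℝ) ^ k < c → sOne ^ k < c := fun hc =>
    (pow_le_pow_left₀ sOne_pos.le h2.le _).trans_lt hc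
  refine ⟨⟨by linarith, by linarith⟩, ⟨lo ?_, hi ?_⟩, ⟨lo ?_, hi ?_⟩, ⟨lo ?_, hi ?_⟩,
    ⟨lo ?_, hi ?_⟩, ⟨lo ?_, hi ?_⟩, ⟨lo ?_, hi ?_⟩, ⟨lo ?_, hi ?_⟩, ⟨lo ?_, hi ?_⟩, ⟨lo ?_, hi ?_⟩,
    ⟨lo ?_, hi ?_⟩⟩ <;> norm_num

lemma legSol_approx {α : ℝ} (hα : |α| ≤ 12) :
    |legSol α sOne - ∑ n ∈ Finset.range 11, legCoeff α n * sOne ^ n|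
        ≤ |legCoeff α 11| * 0.0000009 ∧
      |legSolInt α sOne - ∑ n ∈ Finset.range 11, legCoeff α n * (sOne ^ (n + 1) / (n + 1))|
        ≤ |legCoeff α 11| * 0.0000009 := by
  obtain ⟨h1, h2⟩ := abs_legSol_sub_le (α := α) (s := sOne) (N := 11) (by norm_num; exact hα)
    sOne_pos.le (by linarith [sOne_bounds.2])
  have h3 : |legCoeff α 11| * sOne ^ 11 / (1 - sOne) ≤ |legCoeff α 11| * 0.0000009 := by
    obtain ⟨⟨a, b⟩, -, -, -, -, -, -, -, -, -, -, c⟩ := sOne_pow_bounds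
    rw [div_le_iff₀ (by linarith), mul_assoc]
    refine mul_le_mul_of_nonneg_left ?_ (abs_nonneg _)
    nlinarith
  exact ⟨h1.trans h3, h2.trans h3⟩

/-- The eight test values of `α`, here and below, are chosen so that `3 / (1 + α)` lies within the
three-decimal window of the corresponding `γ`. -/
lemma not_mem_admissible_kappa_left : (-3.8957 : ℝ) ∉ admissible kappa := by
  obtain ⟨h1, h2⟩ := legSol_approx (α := -3.8957) (by rw [abs_le]; norm_num)
  obtain ⟨⟨a1, b1⟩, ⟨a2, b2⟩, ⟨a3, b3⟩, ⟨a4, b4⟩, ⟨a5, b5⟩, ⟨a6, b6⟩, ⟨a7, b7⟩, ⟨a8, b8⟩,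
    ⟨a9, b9⟩, ⟨a10, b10⟩, ⟨a11, b11⟩⟩ := sOne_pow_bounds
  rw [abs_le] at h1 h2
  norm_num [Finset.sum_range_succ, legCoeff] at h1 h2
  obtain ⟨h1, h1'⟩ := h1
  obtain ⟨h2, h2'⟩ := h2
  have hpos : 0 < legSol (-3.8957) sOne := legSol_pos_of_neg (by norm_num) (by norm_num)
    sOne_pos.le (by linarith [sOne_bounds.2])
  have hH : legSol (-3.8957) sOne ≤ 0.266195 := by norm_num; linarith
  have hJ : legSolInt (-3.8957) sOne ≥ 0.159173 := by norm_num; linarith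
  rw [mem_admissible_kappa_iff (by norm_num) hpos, not_le]
  have hm := mul_le_mul_of_nonneg_left hH (by linarith : 0 ≤ (1 + sOne - (-3.8957) * sOne))
  clear h1 h1' h2 h2'
  linarith

lemma mem_admissible_kappa_left : (-3.893 : ℝ) ∈ admissible kappa := by
  obtain ⟨h1, h2⟩ := legSol_approx (α := -3.893) (by rw [abs_le]; norm_num)
  obtain ⟨⟨a1, b1⟩, ⟨a2, b2⟩, ⟨a3, b3⟩, ⟨a4, b4⟩, ⟨a5, b5⟩, ⟨a6, b6⟩, ⟨a7, b7⟩, ⟨a8, b8⟩,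
    ⟨a9, b9⟩, ⟨a10, b10⟩, ⟨a11, b11⟩⟩ := sOne_pow_bounds
  rw [abs_le] at h1 h2
  norm_num [Finset.sum_range_succ, legCoeff] at h1 h2
  obtain ⟨h1, h1'⟩ := h1
  obtain ⟨h2, h2'⟩ := h2
  have hpos : 0 < legSol (-3.893) sOne := legSol_pos_of_neg (by norm_num) (by norm_num)
    sOne_pos.le (by linarith [sOne_bounds.2])
  have hH : legSol (-3.893) sOne ≥ 0.266563 := by norm_num; linarith
  have hJ : legSolInt (-3.893) sOne ≤ 0.159254 := by norm_num; linarith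
  rw [mem_admissible_kappa_iff (by norm_num) hpos]
  have hm := mul_le_mul_of_nonneg_left hH (by linarith : 0 ≤ (1 + sOne - (-3.893) * sOne))
  clear h1 h1' h2 h2'
  linarith

lemma mem_admissible_kappa_right : (10.112 : ℝ) ∈ admissible kappa := by
  obtain ⟨h1, h2⟩ := legSol_approx (α := 10.112) (by rw [abs_le]; norm_num)
  obtain ⟨⟨a1, b1⟩, ⟨a2, b2⟩, ⟨a3, b3⟩, ⟨a4, b4⟩, ⟨a5, b5⟩, ⟨a6, b6⟩, ⟨a7, b7⟩, ⟨a8, b8⟩,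
    ⟨a9, b9⟩, ⟨a10, b10⟩, ⟨a11, b11⟩⟩ := sOne_pow_bounds
  rw [abs_le] at h1 h2
  norm_num [Finset.sum_range_succ, legCoeff] at h1 h2
  obtain ⟨h1, h1'⟩ := h1
  obtain ⟨h2, h2'⟩ := h2
  have hpos : 0 < legSol (10.112) sOne := by norm_num; linarith
  have hH : legSol (10.112) sOne ≤ 5.440045 := by norm_num; linarith
  have hJ : legSolInt (10.112) sOne ≥ 0.793630 := by norm_num; linarith
  rw [mem_admissible_kappa_iff (by norm_num) hpos]
  -- At this `α` the coefficient of `legSol` is negative, which is why an upper bound for `legSol`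
  -- is needed for membership.
  have hm := mul_le_mul_of_nonneg_left hH (by linarith : 0 ≤ -(1 + sOne - (10.112) * sOne))
  clear h1 h1' h2 h2'
  linarith

lemma not_mem_admissible_kappa_right : (10.15 : ℝ) ∉ admissible kappa := by
  obtain ⟨h1, h2⟩ := legSol_approx (α := 10.15) (by rw [abs_le]; norm_num)
  obtain ⟨⟨a1, b1⟩, ⟨a2, b2⟩, ⟨a3, b3⟩, ⟨a4, b4⟩, ⟨a5, b5⟩, ⟨a6, b6⟩, ⟨a7, b7⟩, ⟨a8, b8⟩,
    ⟨a9, b9⟩, ⟨a10, b10⟩, ⟨a11, b11⟩⟩ := sOne_pow_bounds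
  rw [abs_le] at h1 h2
  norm_num [Finset.sum_range_succ, legCoeff] at h1 h2
  obtain ⟨h1, h1'⟩ := h1
  obtain ⟨h2, h2'⟩ := h2
  have hpos : 0 < legSol (10.15) sOne := by norm_num; linarith
  have hH : legSol (10.15) sOne ≥ 5.466489 := by norm_num; linarith
  have hJ : legSolInt (10.15) sOne ≤ 0.796431 := by norm_num; linarith
  rw [mem_admissible_kappa_iff (by norm_num) hpos, not_le]
  have hm := mul_le_mul_of_nonneg_left hH (by linarith : 0 ≤ -(1 + sOne - (10.15) * sOne))
  clear h1 h1' h2 h2'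
  linarith

lemma cosh_sinh_half_bounds :
    (1.127625965 < Real.cosh (1 / 2) ∧ Real.cosh (1 / 2) < 1.127625966) ∧
      0.521095305 < Real.sinh (1 / 2) ∧ Real.sinh (1 / 2) < 0.521095306 := by
  obtain ⟨h1, h2⟩ := sOne_bounds
  have hc := cosh_half_sq
  have hs : Real.sinh (1 / 2) ^ 2 = sOne := rfl
  have hc0 := Real.cosh_pos (1 / 2)
  have hs0 := sinh_half_pos
  refine ⟨⟨lt_of_pow_lt_pow_left₀ 2 hc0.le ?_, lt_of_pow_lt_pow_left₀ 2 (by norm_num) ?_⟩,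
    lt_of_pow_lt_pow_left₀ 2 hs0.le ?_, lt_of_pow_lt_pow_left₀ 2 (by norm_num) ?_⟩
  all_goals first | rw [hc] | rw [hs]
  all_goals norm_num; linarith

lemma coshSqrt_approx {m : ℝ} (hm : |m| ≤ 5) :
    |coshSqrt m - ∑ k ∈ Finset.range 8, m ^ k / ((2 * k).factorial : ℝ)| ≤ 0.0000001 ∧
      |sinhcSqrt m - ∑ k ∈ Finset.range 8, m ^ k / ((2 * k + 1).factorial : ℝ)| ≤ 0.0000001 := by
  have hpow : |m| ^ 8 ≤ 5 ^ 8 := pow_le_pow_left₀ (abs_nonneg m) hm 8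
  constructor
  · refine (abs_sub_sum_range_le (ρ := 1 / 2) (hasSum_coshSqrt m) (by norm_num) (by norm_num)
      fun n hn => ?_).trans ?_
    · rw [show 2 * (n + 1) = 2 * n + 1 + 1 by ring, Nat.factorial_succ, Nat.factorial_succ, pow_succ]
      have hn' : (8 : ℝ) ≤ n := by exact_mod_cast hn
      push_cast
      have e : m ^ n * m / ((2 * n + 1 + 1) * ((2 * n + 1) * ((2 * n).factorial : ℝ)))
          = m ^ n / ((2 * n).factorial : ℝ) * (m / ((2 * n + 1 + 1) * (2 * n + 1))) := by
        field_simp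
      rw [e, abs_mul]
      refine mul_le_mul_of_nonneg_left ?_ (abs_nonneg _)
      rw [abs_div, abs_of_pos (by positivity : (0 : ℝ) < (2 * n + 1 + 1) * (2 * n + 1)),
        div_le_iff₀ (by positivity)]
      nlinarith
    · rw [abs_div, abs_pow]
      norm_num [Nat.factorial]
      linarith
  · refine (abs_sub_sum_range_le (ρ := 1 / 2) (hasSum_sinhcSqrt m) (by norm_num) (by norm_num)
      fun n hn => ?_).trans ?_
    · rw [show 2 * (n + 1) + 1 = 2 * n + 1 + 1 + 1 by ring, Nat.factorial_succ (2 * n + 1 + 1),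
        Nat.factorial_succ (2 * n + 1), pow_succ]
      have hn' : (8 : ℝ) ≤ n := by exact_mod_cast hn
      push_cast
      have e : m ^ n * m / ((2 * n + 1 + 1 + 1) * ((2 * n + 1 + 1) * ((2 * n + 1).factorial : ℝ)))
          = m ^ n / ((2 * n + 1).factorial : ℝ) * (m / ((2 * n + 1 + 1 + 1) * (2 * n + 1 + 1))) := by
        field_simp
      rw [e, abs_mul]
      refine mul_le_mul_of_nonneg_left ?_ (abs_nonneg _)
      rw [abs_div, abs_of_pos (by positivity : (0 : ℝ) < (2 * n + 1 + 1 + 1) * (2 * n + 1 + 1)),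
        div_le_iff₀ (by positivity)]
      nlinarith
    · rw [abs_div, abs_pow]
      norm_num [Nat.factorial]
      linarith

lemma neg_pi_sq_lt {m : ℝ} (hm : -9 ≤ m) : -Real.pi ^ 2 < m := by
  nlinarith [Real.pi_gt_three]

lemma mem_admissible_one_iff {α m : ℝ} (hm : -9 ≤ m) (h : α + 1 / 4 = m) :
    α ∈ admissible 1 ↔ 0 ≤ Real.cosh (1 / 2) * coshSqrt m - 1
      + (1 / 2 - α) * (Real.sinh (1 / 2) * sinhcSqrt m) := by
  subst h
  have hpos : 0 < Real.sinh (1 / 2) * sinhcSqrt (α + 1 / 4) :=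
    mul_pos sinh_half_pos (sinhcSqrt_pos (neg_pi_sq_lt hm))
  rw [mem_admissible, energyGE_one_iff (neg_pi_sq_lt hm), minOne, ← sub_nonneg]
  have e : -1 / 2 + (Real.cosh (1 / 2) * coshSqrt (α + 1 / 4) - 1) /
      (Real.sinh (1 / 2) * sinhcSqrt (α + 1 / 4)) - (α - 1 ^ 2)
      = (Real.cosh (1 / 2) * coshSqrt (α + 1 / 4) - 1
      + (1 / 2 - α) * (Real.sinh (1 / 2) * sinhcSqrt (α + 1 / 4))) /
      (Real.sinh (1 / 2) * sinhcSqrt (α + 1 / 4)) := by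
    have := sinh_half_pos.ne'
    have hS := (sinhcSqrt_pos (neg_pi_sq_lt hm)).ne'
    generalize sinhcSqrt (α + 1 / 4) = S at hS ⊢
    field_simp
    ring
  rw [e, le_div_iff₀ hpos, zero_mul]

lemma not_mem_admissible_one_left : (-2.9893 : ℝ) ∉ admissible 1 := by
  obtain ⟨h1, h2⟩ := coshSqrt_approx (m := -2.7393) (by rw [abs_le]; norm_num)
  rw [abs_le] at h1 h2
  norm_num [Finset.sum_range_succ, Nat.factorial] at h1 h2
  rw [mem_admissible_one_iff (m := -2.7393) (by norm_num) (by norm_num), not_le]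
  have hC : coshSqrt (-2.7393) ≤ -0.0841868 := by norm_num; linarith
  have hS : sinhcSqrt (-2.7393) ≤ 0.6020546 := by norm_num; linarith
  obtain ⟨⟨c1, c2⟩, s1, s2⟩ := cosh_sinh_half_bounds
  have h3 := mul_le_mul_of_nonneg_left hC (by linarith : 0 ≤ Real.cosh (1 / 2))
  have h4 := mul_le_mul_of_nonneg_left hS (by linarith : 0 ≤ Real.sinh (1 / 2))
  clear h1 h2
  linarith

lemma mem_admissible_one_left : (-2.9881 : ℝ) ∈ admissible 1 := by
  obtain ⟨h1, h2⟩ := coshSqrt_approx (m := -2.7381) (by rw [abs_le]; norm_num)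
  rw [abs_le] at h1 h2
  norm_num [Finset.sum_range_succ, Nat.factorial] at h1 h2
  rw [mem_admissible_one_iff (m := -2.7381) (by norm_num) (by norm_num)]
  have hC : coshSqrt (-2.7381) ≥ -0.0838259 := by norm_num; linarith
  have hS : sinhcSqrt (-2.7381) ≥ 0.6022045 := by norm_num; linarith
  obtain ⟨⟨c1, c2⟩, s1, s2⟩ := cosh_sinh_half_bounds
  have h3 := mul_le_mul_of_nonneg_left hC (by linarith : 0 ≤ Real.cosh (1 / 2))
  have h4 := mul_le_mul_of_nonneg_left hS (by linarith : 0 ≤ Real.sinh (1 / 2))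
  clear h1 h2
  linarith

lemma mem_admissible_one_right : (4.209 : ℝ) ∈ admissible 1 := by
  obtain ⟨h1, h2⟩ := coshSqrt_approx (m := 4.459) (by rw [abs_le]; norm_num)
  rw [abs_le] at h1 h2
  norm_num [Finset.sum_range_succ, Nat.factorial] at h1 h2
  rw [mem_admissible_one_iff (m := 4.459) (by norm_num) (by norm_num)]
  have hC : coshSqrt (4.459) ≥ 4.1913866 := by norm_num; linarith
  have hS : sinhcSqrt (4.459) ≤ 1.9275814 := by norm_num; linarith
  obtain ⟨⟨c1, c2⟩, s1, s2⟩ := cosh_sinh_half_bounds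
  have h3 := mul_le_mul_of_nonneg_left hC (by linarith : 0 ≤ Real.cosh (1 / 2))
  have h4 := mul_le_mul_of_nonneg_left hS (by linarith : 0 ≤ Real.sinh (1 / 2))
  clear h1 h2
  linarith

lemma not_mem_admissible_one_right : (4.215 : ℝ) ∉ admissible 1 := by
  obtain ⟨h1, h2⟩ := coshSqrt_approx (m := 4.465) (by rw [abs_le]; norm_num)
  rw [abs_le] at h1 h2
  norm_num [Finset.sum_range_succ, Nat.factorial] at h1 h2
  rw [mem_admissible_one_iff (m := 4.465) (by norm_num) (by norm_num), not_le]
  have hC : coshSqrt (4.465) ≤ 4.1971720 := by norm_num; linarith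
  have hS : sinhcSqrt (4.465) ≥ 1.9291045 := by norm_num; linarith
  obtain ⟨⟨c1, c2⟩, s1, s2⟩ := cosh_sinh_half_bounds
  have h3 := mul_le_mul_of_nonneg_left hC (by linarith : 0 ≤ Real.cosh (1 / 2))
  have h4 := mul_le_mul_of_nonneg_left hS (by linarith : 0 ≤ Real.sinh (1 / 2))
  clear h1 h2
  linarith

lemma minOne_neg_one_bounds : -1.0882 < minOne (-1) ∧ minOne (-1) ≤ -1.08765 := by
  obtain ⟨h1, h2⟩ := coshSqrt_approx (m := -3 / 4) (by rw [abs_le]; norm_num)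
  rw [abs_le] at h1 h2
  norm_num [Finset.sum_range_succ, Nat.factorial] at h1 h2
  obtain ⟨⟨c1, c2⟩, s1, s2⟩ := cosh_sinh_half_bounds
  have hpos : 0 < Real.sinh (1 / 2) * sinhcSqrt (-3 / 4) :=
    mul_pos sinh_half_pos (sinhcSqrt_pos (neg_pi_sq_lt (by norm_num)))
  have e : minOne (-1) = -1 / 2 + (Real.cosh (1 / 2) * coshSqrt (-3 / 4) - 1) /
      (Real.sinh (1 / 2) * sinhcSqrt (-3 / 4)) := by
    rw [minOne]; norm_num
  have C1 : coshSqrt (-3 / 4) ≤ 0.647860 := by norm_num; linarith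
  have C2 : 0.647858 ≤ coshSqrt (-3 / 4) := by norm_num; linarith
  have S1 : sinhcSqrt (-3 / 4) ≤ 0.879606 := by norm_num; linarith
  have S2 : 0.879604 ≤ sinhcSqrt (-3 / 4) := by norm_num; linarith
  clear h1 h2
  have t1 := mul_le_mul_of_nonneg_left C1 (by linarith : 0 ≤ Real.cosh (1 / 2))
  have t2 := mul_le_mul_of_nonneg_left C2 (by linarith : 0 ≤ Real.cosh (1 / 2))
  have t3 := mul_le_mul_of_nonneg_left S1 (by linarith : 0 ≤ Real.sinh (1 / 2))
  have t4 := mul_le_mul_of_nonneg_left S2 (by linarith : 0 ≤ Real.sinh (1 / 2))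
  rw [e]
  constructor
  · have : -0.5882 < (Real.cosh (1 / 2) * coshSqrt (-3 / 4) - 1) /
        (Real.sinh (1 / 2) * sinhcSqrt (-3 / 4)) := by
      rw [lt_div_iff₀ hpos]; linarith
    linarith
  · have : (Real.cosh (1 / 2) * coshSqrt (-3 / 4) - 1) /
        (Real.sinh (1 / 2) * sinhcSqrt (-3 / 4)) ≤ -0.58765 := by
      rw [div_le_iff₀ hpos]; linarith
    linarith

/-- At `α = -1` one has `α + 1/4 = -(√3/2)²`, so the hyperbolic functions become trigonometric at
`√3/2`. -/
lemma explicit_bound_eq :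
    Real.sqrt 3 * (1 - Real.cosh (1 / 2) * Real.cos (Real.sqrt 3 / 2)) /
      (2 * Real.sinh (1 / 2) * Real.sin (Real.sqrt 3 / 2)) - 1 / 2 = -1 - minOne (-1) := by
  have h3 : (0 : ℝ) < Real.sqrt 3 := Real.sqrt_pos.2 (by norm_num)
  have hm : -(Real.sqrt 3 / 2) ^ 2 = -3 / 4 := by
    rw [div_pow, Real.sq_sqrt (by norm_num)]; norm_num
  have hc := coshSqrt_neg_sq (Real.sqrt 3 / 2)
  have hs := mul_sinhcSqrt_neg_sq (Real.sqrt 3 / 2)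
  have hpos := sinhcSqrt_pos (m := -3 / 4) (neg_pi_sq_lt (by norm_num))
  have hsh := sinh_half_pos
  rw [hm] at hc hs
  rw [← hc, ← hs, minOne, show (-1 : ℝ) + 1 / 4 = -3 / 4 by norm_num]
  field_simp
  ring

lemma zero_mem_admissible {β : ℝ} (hw : ∀ x ∈ Set.Icc (0 : ℝ) 1, 0 ≤ weight β x) :
    (0 : ℝ) ∈ admissible β :=
  mem_admissible.2 ((energyGE_zero hw).mono (by nlinarith [sq_nonneg β]))

lemma zero_mem_admissible_one : (0 : ℝ) ∈ admissible 1 :=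
  zero_mem_admissible fun x _ => weight_one_nonneg x

lemma zero_mem_admissible_kappa : (0 : ℝ) ∈ admissible kappa :=
  zero_mem_admissible fun _ hx => weight_kappa_nonneg hx.1

lemma admissible_endpoint_bounds {β a a' b b' : ℝ} (h0 : (0 : ℝ) ∈ admissible β) (ha : a < 0)
    (ha' : a ∉ admissible β) (hb : 0 < b) (hb' : b ∉ admissible β) (hm : a' ∈ admissible β)
    (hp : b' ∈ admissible β) :
    (a < alphaMinus β ∧ alphaMinus β ≤ a') ∧ b' ≤ alphaPlus β ∧ alphaPlus β < b := by
  have hc := isCompact_admissible h0 ha ha' hb hb'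
  exact ⟨⟨lt_of_mem_admissible h0 ha ha' (hc.sInf_mem ⟨0, h0⟩), csInf_le hc.bddBelow hm⟩,
    le_csSup hc.bddAbove hp, gt_of_mem_admissible h0 hb hb' (hc.sSup_mem ⟨0, h0⟩)⟩

lemma admissible_kappa_eq : admissible kappa = Set.Icc (alphaMinus kappa) (alphaPlus kappa) :=
  admissible_eq_Icc zero_mem_admissible_kappa (by norm_num) not_mem_admissible_kappa_left
    (by norm_num) not_mem_admissible_kappa_right

lemma admissible_one_eq : admissible 1 = Set.Icc (alphaMinus 1) (alphaPlus 1) :=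
  admissible_eq_Icc zero_mem_admissible_one (by norm_num) not_mem_admissible_one_left
    (by norm_num) not_mem_admissible_one_right

lemma alpha_kappa_bounds :
    (-3.8957 < alphaMinus kappa ∧ alphaMinus kappa ≤ -3.893) ∧
      10.112 ≤ alphaPlus kappa ∧ alphaPlus kappa < 10.15 :=
  admissible_endpoint_bounds zero_mem_admissible_kappa (by norm_num)
    not_mem_admissible_kappa_left (by norm_num) not_mem_admissible_kappa_right
    mem_admissible_kappa_left mem_admissible_kappa_right

lemma alpha_one_bounds :
    (-2.9893 < alphaMinus 1 ∧ alphaMinus 1 ≤ -2.9881) ∧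
      4.209 ≤ alphaPlus 1 ∧ alphaPlus 1 < 4.215 :=
  admissible_endpoint_bounds zero_mem_admissible_one (by norm_num)
    not_mem_admissible_one_left (by norm_num) not_mem_admissible_one_right
    mem_admissible_one_left mem_admissible_one_right

lemma gammaOneMinus_bounds : -1.037 < gammaOneMinus ∧ gammaOneMinus ≤ -1.036 := by
  obtain ⟨⟨h1, h2⟩, -⟩ := alpha_kappa_bounds
  rw [gammaOneMinus, lt_div_iff_of_neg (by linarith), div_le_iff_of_neg (by linarith)]
  constructor <;> linarith

lemma gammaOnePlus_bounds : 0.269 ≤ gammaOnePlus ∧ gammaOnePlus < 0.270 := by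
  obtain ⟨-, h1, h2⟩ := alpha_kappa_bounds
  rw [gammaOnePlus, le_div_iff₀ (by linarith), div_lt_iff₀ (by linarith)]
  constructor <;> linarith

lemma gammaTwoMinus_bounds : -1.509 < gammaTwoMinus ∧ gammaTwoMinus ≤ -1.508 := by
  obtain ⟨⟨h1, h2⟩, -⟩ := alpha_one_bounds
  rw [gammaTwoMinus, lt_div_iff_of_neg (by linarith), div_le_iff_of_neg (by linarith)]
  constructor <;> linarith

lemma gammaTwoPlus_bounds : 0.575 ≤ gammaTwoPlus ∧ gammaTwoPlus < 0.576 := by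
  obtain ⟨-, h1, h2⟩ := alpha_one_bounds
  rw [gammaTwoPlus, le_div_iff₀ (by linarith), div_lt_iff₀ (by linarith)]
  constructor <;> linarith

/-! ### From `γ` to `α`; finiteness and the square-root bound -/

lemma alphaOf_eq {γ : ℝ} (hγ : γ ≠ 0) : alphaOf γ = 3 / γ - 1 := by
  rw [alphaOf]; field_simp

section AlphaOf

variable {γ a : ℝ}

lemma le_alphaOf_of_neg (hγ : γ < 0) (ha : 1 + a < 0) (h : γ ≤ 3 / (1 + a)) : a ≤ alphaOf γ := by
  have h1 : 1 + a ≤ 3 / γ := by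
    rw [le_div_iff_of_neg ha] at h
    rw [le_div_iff_of_neg hγ]; linarith
  rw [alphaOf_eq hγ.ne]; linarith

lemma alphaOf_le_of_neg (hγ : γ < 0) (ha : 1 + a < 0) (h : 3 / (1 + a) ≤ γ) : alphaOf γ ≤ a := by
  have h1 : 3 / γ ≤ 1 + a := by
    rw [div_le_iff_of_neg ha] at h
    rw [div_le_iff_of_neg hγ]; linarith
  rw [alphaOf_eq hγ.ne]; linarith

lemma alphaOf_le_of_pos (hγ : 0 < γ) (ha : 0 < 1 + a) (h : 3 / (1 + a) ≤ γ) : alphaOf γ ≤ a := by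
  have h1 : 3 / γ ≤ 1 + a := by
    rw [div_le_iff₀ ha] at h
    rw [div_le_iff₀ hγ]; linarith
  rw [alphaOf_eq hγ.ne']; linarith

lemma le_alphaOf_of_pos (hγ : 0 < γ) (ha : 0 < 1 + a) (h : γ ≤ 3 / (1 + a)) : a ≤ alphaOf γ := by
  have h1 : 1 + a ≤ 3 / γ := by
    rw [le_div_iff₀ ha] at h
    rw [le_div_iff₀ hγ]; linarith
  rw [alphaOf_eq hγ.ne']; linarith

/-- The map `γ ↦ 3/γ - 1` sends the two outer half-lines into one interval around `-1`, which
corresponds to `γ = ±∞`. -/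
lemma alphaOf_mem_Icc {a b : ℝ} (ha : 1 + a < 0) (hb : 0 < 1 + b)
    (h : γ ≤ 3 / (1 + a) ∨ 3 / (1 + b) ≤ γ) : γ ≠ 0 ∧ alphaOf γ ∈ Set.Icc a b := by
  rcases h with h | h
  · have hγ : γ < 0 := h.trans_lt (div_neg_of_pos_of_neg (by norm_num) ha)
    refine ⟨hγ.ne, le_alphaOf_of_neg hγ ha h, ?_⟩
    have : 3 / γ < 0 := div_neg_of_pos_of_neg (by norm_num) hγ
    rw [alphaOf_eq hγ.ne]; linarith
  · have hγ : 0 < γ := (div_pos (by norm_num) hb).trans_le h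
    refine ⟨hγ.ne', ?_, alphaOf_le_of_pos hγ hb h⟩
    have : 0 < 3 / γ := div_pos (by norm_num) hγ
    rw [alphaOf_eq hγ.ne']; linarith

end AlphaOf

/-- The optimal `β` as a function of `α`. -/
def optBeta (α : ℝ) : ℝ≥0∞ :=
  sInf {b : ℝ≥0∞ | ∃ β : ℝ≥0, 0 ≤ gap α (β : ℝ) ∧ b = (β : ℝ≥0∞)}

lemma optBeta_le {α β : ℝ} (hβ : 0 ≤ β) (h : EnergyGE α β (α - β ^ 2)) :
    optBeta α ≤ ENNReal.ofReal β :=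
  sInf_le ⟨β.toNNReal, by rw [Real.coe_toNNReal _ hβ]; exact zero_le_gap_iff.2 h, rfl⟩

lemma betaGamma_le {γ β : ℝ} (hβ : 0 ≤ β) (h : EnergyGE (alphaOf γ) β (alphaOf γ - β ^ 2)) :
    betaGamma γ ≤ ENNReal.ofReal β :=
  optBeta_le hβ h

lemma kappa_pos : 0 < kappa := by
  rw [kappa_eq]; exact div_pos (Real.cosh_pos _) sinh_half_pos

lemma betaGamma_lt_top {γ : ℝ} (h : γ ≤ gammaOneMinus ∨ gammaOnePlus ≤ γ) : betaGamma γ < ⊤ := by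
  obtain ⟨⟨h1, h2⟩, h3, h4⟩ := alpha_kappa_bounds
  have hm := (alphaOf_mem_Icc (by linarith) (by linarith) h).2
  rw [← admissible_kappa_eq] at hm
  exact (betaGamma_le kappa_pos.le (mem_admissible.1 hm)).trans_lt ENNReal.ofReal_lt_top

lemma integral_weight (β : ℝ) : ∫ x in (0 : ℝ)..1, weight β x = 1 := by
  have hd : ∀ x ∈ Set.uIcc (0 : ℝ) 1, HasDerivAt
      (fun x => (Real.sinh (x - 1 / 2) + β * Real.cosh (x - 1 / 2)) / (2 * Real.sinh (1 / 2)))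
      (weight β x) x := fun x _ => by
    have h := (hasDerivAt_id x).sub_const (1 / 2)
    refine ((h.sinh.add (h.cosh.const_mul β)).div_const _).congr_deriv ?_
    simp [weight]
  rw [intervalIntegral.integral_eq_sub_of_hasDerivAt hd ((continuous_weight β).intervalIntegrable _ _)]
  have h1 : (1 - 1 / 2 : ℝ) = 1 / 2 := by norm_num
  have h2 : (0 - 1 / 2 : ℝ) = -(1 / 2) := by norm_num
  have := sinh_half_pos.ne'
  rw [h1, h2, Real.sinh_neg, Real.cosh_neg]
  field_simp
  ring

/-- The constant `1` is a competitor of energy `α`, since the weight has total mass one for every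
`β`. -/
lemma le_of_energyGE {α β t : ℝ} (h : EnergyGE α β t) : t ≤ α := by
  have hH : IsH1 (fun _ => 1) (fun _ => 0) :=
    isH1_of_hasDerivAt (fun x _ => hasDerivAt_const x 1) continuousOn_const
  have := h _ _ hH rfl rfl
  rw [hH.energy_eq_add] at this
  simpa [integral_weight] using this

/-- The upper bound for the optimal `β` at `α` obtained from convexity on `[-1, 1]`. -/
lemma energyGE_sqrt {α : ℝ} (hα : -9 ≤ α + 1 / 4) (h : α ∈ admissible 1) :
    0 ≤ α - minOne α ∧ Real.sqrt (α - minOne α) ≤ 1 ∧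
      EnergyGE α (Real.sqrt (α - minOne α)) (α - Real.sqrt (α - minOne α) ^ 2) := by
  have hπ := neg_pi_sq_lt hα
  have h0 : 0 ≤ α - minOne α := sub_nonneg.2 (le_of_energyGE (energyGE_minOne hπ).1)
  have h1 : α - 1 ^ 2 ≤ minOne α := (energyGE_one_iff hπ).1 (mem_admissible.1 h)
  -- Admissibility of `α` at `β = 1` is exactly what keeps the chosen `β` within `[-1,1]`, where the
  -- constant bound holds.
  have h2 : Real.sqrt (α - minOne α) ≤ 1 := Real.sqrt_le_one.2 (by linarith)
  refine ⟨h0, h2, (energyGE_of_abs_le_one hπ ?_ h2).mono ?_⟩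
  · linarith [Real.sqrt_nonneg (α - minOne α)]
  · rw [Real.sq_sqrt h0]; linarith

lemma sq_eq_of_two_mul_sq_eq {γ : ℝ} {μ : ℂ}
    (hμ : (2 * μ) ^ 2 = 1 + 4 * ((3 - (γ : ℂ)) / (γ : ℂ))) : μ ^ 2 = (alphaOf γ + 1 / 4 : ℝ) := by
  rw [alphaOf]
  push_cast
  linear_combination hμ / 4

lemma betaGamma_le_sqrt {γ : ℝ} (h : γ ≤ gammaTwoMinus ∨ gammaTwoPlus ≤ γ) {μ : ℂ}
    (hμ : (2 * μ) ^ 2 = 1 + 4 * ((3 - (γ : ℂ)) / (γ : ℂ))) :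
    ∃ r : ℝ, 0 ≤ r ∧ (r : ℂ) = 3 / (γ : ℂ) - 1 / 2 - hypTerm μ ∧
      betaGamma γ ≤ ENNReal.ofReal (Real.sqrt r) := by
  obtain ⟨⟨h1, h2⟩, h3, h4⟩ := alpha_one_bounds
  obtain ⟨hγ, hm⟩ := alphaOf_mem_Icc (by linarith) (by linarith) h
  have hα : -9 ≤ alphaOf γ + 1 / 4 := by linarith [hm.1]
  rw [← admissible_one_eq] at hm
  obtain ⟨h5, -, h6⟩ := energyGE_sqrt hα hm
  refine ⟨_, h5, ?_, betaGamma_le (Real.sqrt_nonneg _) h6⟩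
  rw [hypTerm_eq (neg_pi_sq_lt hα) (sq_eq_of_two_mul_sq_eq hμ)]
  have : alphaOf γ - minOne (alphaOf γ) = 3 / γ - 1 / 2 - (minOne (alphaOf γ) + 1 / 2) := by
    have := alphaOf_eq hγ; linarith
  rw [this]; push_cast; ring

/-! ### The bound between `β = 1` and `β = coth ½` -/

/-- A strict inequality at `α` propagates a little towards any `α'` with a finite bound. -/
lemma exists_mem_admissible {α α' β t t' : ℝ} (h : EnergyGE α β t) (h' : EnergyGE α' β t')
    (ht : α - β ^ 2 < t) : ∃ θ : ℝ, 0 < θ ∧ θ ≤ 1 ∧ (1 - θ) * α + θ * α' ∈ admissible β := by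
  -- The slack `t - (α - β²)` changes along the segment at a rate of absolute value at most `D`, so
  -- it stays nonnegative up to `θ = slack / D`; adding the slack to `D` keeps `D` positive and `θ ≤
  -- 1`.
  set D := |t' - t - (α' - α)| + (t - (α - β ^ 2)) with hD
  have hδ : 0 < t - (α - β ^ 2) := by linarith
  have hD0 : 0 < D := by positivity
  refine ⟨(t - (α - β ^ 2)) / D, by positivity, ?_, ?_⟩
  · rw [div_le_one hD0]; linarith [abs_nonneg (t' - t - (α' - α))]
  · have hθ1 : (t - (α - β ^ 2)) / D ≤ 1 := by
      rw [div_le_one hD0]; linarith [abs_nonneg (t' - t - (α' - α))]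
    have hθD : (t - (α - β ^ 2)) / D * D = t - (α - β ^ 2) := div_mul_cancel₀ _ hD0.ne'
    have hθ0 : 0 ≤ (t - (α - β ^ 2)) / D := by positivity
    set θ := (t - (α - β ^ 2)) / D with hθ
    refine mem_admissible.2 ((h.affine_left h' hθ0 hθ1).mono ?_)
    have h1 := mul_le_mul_of_nonneg_left (neg_abs_le (t' - t - (α' - α))) hθ0
    rw [hD] at hθD
    nlinarith

/-- A positive gap at `α` would persist slightly to its left by concavity, producing an admissible
point below `alphaMinus 1`. The endpoint itself is included. -/
lemma minOne_le_of_le_alphaMinus {α : ℝ} (hα : -8 ≤ α + 1 / 4) (h : α ≤ alphaMinus 1) :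
    minOne α ≤ α - 1 := by
  by_contra hc
  obtain ⟨θ, h0, h1, h2⟩ := exists_mem_admissible (β := 1) (t := minOne α)
    (energyGE_minOne (neg_pi_sq_lt (by linarith : -9 ≤ α + 1 / 4))).1
    (energyGE_minOne (neg_pi_sq_lt (by linarith : -9 ≤ (α - 1) + 1 / 4))).1 (by linarith)
  rw [admissible_one_eq] at h2
  linarith [h2.1]

lemma minOne_le_of_alphaPlus_le {α : ℝ} (h : alphaPlus 1 ≤ α) : minOne α ≤ α - 1 := by
  have hα := alpha_one_bounds.2.1
  by_contra hc
  obtain ⟨θ, h0, h1, h2⟩ := exists_mem_admissible (β := 1) (t := minOne α)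
    (energyGE_minOne (neg_pi_sq_lt (by linarith : -9 ≤ α + 1 / 4))).1
    (energyGE_minOne (neg_pi_sq_lt (by linarith : -9 ≤ (α + 1) + 1 / 4))).1 (by linarith)
  rw [admissible_one_eq] at h2
  linarith [h2.2]

/-- The larger root of a monic quadratic polynomial that changes sign from `s` to `t`. -/
lemma larger_root_mem_Icc {b c s t : ℝ} (hst : s < t) (hs : s ^ 2 + b * s + c ≤ 0)
    (ht : 0 ≤ t ^ 2 + b * t + c) :
    0 ≤ b ^ 2 - 4 * c ∧ -b / 2 + 1 / 2 * Real.sqrt (b ^ 2 - 4 * c) ∈ Set.Icc s t ∧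
      (-b / 2 + 1 / 2 * Real.sqrt (b ^ 2 - 4 * c)) ^ 2
        + b * (-b / 2 + 1 / 2 * Real.sqrt (b ^ 2 - 4 * c)) + c = 0 := by
  have h1 : (2 * s + b) ^ 2 ≤ b ^ 2 - 4 * c := by nlinarith
  have hD : 0 ≤ b ^ 2 - 4 * c := (sq_nonneg _).trans h1
  have h2 : b ^ 2 - 4 * c ≤ (2 * t + b) ^ 2 := by nlinarith
  -- Otherwise `2 s + b < 2 t + b < 0` would give `(2 t + b)² < (2 s + b)²`, against `h1` and `h2`.
  have h3 : 0 ≤ 2 * t + b := by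
    by_contra h
    nlinarith
  have h4 : 2 * s + b ≤ Real.sqrt (b ^ 2 - 4 * c) := Real.le_sqrt_of_sq_le h1
  have h5 : Real.sqrt (b ^ 2 - 4 * c) ≤ 2 * t + b := Real.sqrt_le_iff.2 ⟨h3, h2⟩
  have h6 := Real.sq_sqrt hD
  exact ⟨hD, ⟨by linarith, by linarith⟩, by nlinarith⟩

lemma betaGamma_le_root {γ : ℝ}
    (h : (gammaTwoMinus ≤ γ ∧ γ ≤ gammaOneMinus) ∨ (gammaOnePlus ≤ γ ∧ γ ≤ gammaTwoPlus)) {μ : ℂ}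
    (hμ : (2 * μ) ^ 2 = 1 + 4 * ((3 - (γ : ℂ)) / (γ : ℂ))) :
    legendreP (-1 / 2 + μ) (Complex.cosh 1) ≠ 0 ∧
      ∃ b c : ℝ,
        (b : ℂ) = ((Real.exp 1 - 1) / 2 : ℝ) * (legTerm μ - (-1 / 2 + hypTerm μ)) ∧
        (c : ℂ) = ((Real.exp 1 + 1) / 2 : ℝ) * (-1 / 2 + hypTerm μ)
          - ((Real.exp 1 - 1) / 2 : ℝ) * legTerm μ - (3 - (γ : ℂ)) / (γ : ℂ) ∧
        0 ≤ b ^ 2 - 4 * c ∧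
        betaGamma γ ≤ ENNReal.ofReal (-b / 2 + 1 / 2 * Real.sqrt (b ^ 2 - 4 * c)) := by
  obtain ⟨⟨h1, h2⟩, h3, h4⟩ := alpha_kappa_bounds
  obtain ⟨⟨k1, k2⟩, k3, k4⟩ := alpha_one_bounds
  have hm : alphaOf γ ∈ admissible kappa := by
    rw [admissible_kappa_eq]
    exact (alphaOf_mem_Icc (by linarith) (by linarith) (h.imp And.right And.left)).2
  have hα : -3.9 ≤ alphaOf γ := by
    rw [admissible_kappa_eq] at hm; linarith [hm.1]
  have hone : minOne (alphaOf γ) ≤ alphaOf γ - 1 := by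
    rcases h with h | h
    · have hγ : γ < 0 := by linarith [gammaOneMinus_bounds.2, h.2]
      exact minOne_le_of_le_alphaMinus (by linarith) (alphaOf_le_of_neg hγ (by linarith) h.1)
    · have hγ : 0 < γ := by linarith [gammaOnePlus_bounds.1, h.1]
      exact minOne_le_of_alphaPlus_le (le_alphaOf_of_pos hγ (by linarith) h.2)
  have hkap : alphaOf γ - kappa ^ 2 ≤ minKappa (alphaOf γ) :=
    (energyGE_kappa_iff hα).1 (mem_admissible.1 hm)
  have hsq := sq_eq_of_two_mul_sq_eq hμ
  have hπ : -Real.pi ^ 2 < alphaOf γ + 1 / 4 := neg_pi_sq_lt (by linarith)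
  have hν : (-1 / 2 + μ) * (-1 / 2 + μ + 1) = (alphaOf γ : ℂ) := by
    have : (-1 / 2 + μ) * (-1 / 2 + μ + 1) = μ ^ 2 - 1 / 4 := by ring
    rw [this, hsq]; push_cast; ring
  have hαc : (3 - (γ : ℂ)) / (γ : ℂ) = (alphaOf γ : ℂ) := by rw [alphaOf]; push_cast; rfl
  rw [legendreP_cosh_one hν, legTerm_eq hsq, hypTerm_eq hπ hsq, hαc]
  refine ⟨by exact_mod_cast legSol_ne_zero hα sOne_pos.le le_rfl, ?_⟩
  set α := alphaOf γ
  set k := (Real.exp 1 - 1) / 2 with hk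
  have hk0 : 0 < k := by
    have := Real.exp_one_gt_d9
    rw [hk]; linarith
  have hk1 : (Real.exp 1 + 1) / 2 = k + 1 := by rw [hk]; ring
  have hκ : kappa = 1 + 1 / k := by
    rw [kappa, hk]
    have : Real.exp 1 - 1 ≠ 0 := by linarith
    field_simp
    ring
  have hkκ : k * (kappa - 1) = 1 := by rw [hκ]; field_simp; ring
  have hκ1 : 1 < kappa := by rw [hκ]; linarith [one_div_pos.2 hk0]
  -- Since `k = 1 / (κ - 1)`, the chord through the values at `1` and `κ` is `β ↦ bβ + c + α`. A
  -- root of `β² + bβ + c` is thus a `β` at which the chord equals `α - β²`.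
  set b := k * (minKappa α - minOne α) with hb
  set c := (k + 1) * minOne α - k * minKappa α - α with hc
  have hq1 : 1 ^ 2 + b * 1 + c ≤ 0 := by rw [hb, hc]; linarith
  have hq2 : 0 ≤ kappa ^ 2 + b * kappa + c := by
    have : b * kappa + c = minKappa α - α := by
      rw [hb, hc]; linear_combination (minKappa α - minOne α) * hkκ
    linarith
  obtain ⟨hD, ⟨hβ1, hβ2⟩, hroot⟩ := larger_root_mem_Icc hκ1 hq1 hq2
  refine ⟨b, c, ?_, ?_, hD, betaGamma_le (by linarith) ?_⟩
  · rw [hb]; push_cast; ring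
  · rw [hc, hk1]; push_cast; ring
  · set β := -b / 2 + 1 / 2 * Real.sqrt (b ^ 2 - 4 * c)
    have hθ0 : 0 ≤ k * (β - 1) := mul_nonneg hk0.le (by linarith)
    have hθ1 : k * (β - 1) ≤ 1 := by
      rw [← hkκ]; exact mul_le_mul_of_nonneg_left (by linarith) hk0.le
    have := (energyGE_minOne hπ).1.affine_right (energyGE_minKappa hα) hθ0 hθ1
    have e1 : (1 - k * (β - 1)) * 1 + k * (β - 1) * kappa = β := by
      linear_combination (β - 1) * hkκ
    have e2 : (1 - k * (β - 1)) * minOne α + k * (β - 1) * minKappa α = α - β ^ 2 := by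
      rw [hb, hc] at hroot
      linear_combination hroot
    rwa [e1, e2] at this

/-! ### The limit `γ → ±∞`: continuity at `α = -1` -/

lemma weight_nonneg_of_abs_le_one {β : ℝ} (h1 : -1 ≤ β) (h2 : β ≤ 1) (x : ℝ) :
    0 ≤ weight β x := by
  have e : weight β x = (1 + β) / 2 * weight 1 x + (1 - β) / 2 * weight (-1) x := by
    simp only [weight]; ring
  have hw := weight_one_nonneg x
  have hw' : 0 ≤ weight (-1) x := by rw [weight_neg]; exact weight_one_nonneg _
  have h3 : 0 ≤ (1 + β) / 2 := by linarith
  have h4 : 0 ≤ (1 - β) / 2 := by linarith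
  rw [e]; positivity

lemma EnergyGE.mono_left {α α' β t : ℝ} (hw : ∀ x, 0 ≤ weight β x) (h : EnergyGE α β t)
    (hα : α ≤ α') : EnergyGE α' β t := by
  intro u g hu h0 h1
  refine (h u g hu h0 h1).trans ?_
  rw [hu.energy_eq_add, hu.energy_eq_add]
  have : 0 ≤ ∫ x in (0 : ℝ)..1, weight β x * u x ^ 2 :=
    intervalIntegral.integral_nonneg zero_le_one fun x _ => mul_nonneg (hw x) (sq_nonneg _)
  linarith [mul_le_mul_of_nonneg_right hα this]

/-- The `β`-part of the weight is odd about `1/2`. Symmetric competitors therefore give upper bounds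
uniform in `β`. -/
lemma integral_weight_mul_of_symm {β : ℝ} {f : ℝ → ℝ} (hf : Continuous f)
    (hs : ∀ x, f (1 - x) = f x) :
    ∫ x in (0 : ℝ)..1, weight β x * f x = ∫ x in (0 : ℝ)..1, weight 0 x * f x := by
  have h1 : ∫ x in (0 : ℝ)..1, weight β x * f x = ∫ x in (0 : ℝ)..1, weight (-β) x * f x := by
    have h := intervalIntegral.integral_comp_sub_left (a := 0) (b := 1)
      (fun x => weight β x * f x) 1
    simp only [sub_zero, sub_self, hs] at h
    rw [← h]
    simp only [weight_neg]
  have hi : ∀ c, IntervalIntegrable (fun x => weight c x * f x) volume 0 1 := fun c =>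
    ((continuous_weight c).mul hf).intervalIntegrable _ _
  have h2 : ∫ x in (0 : ℝ)..1, weight 0 x * f x
      = 1 / 2 * (∫ x in (0 : ℝ)..1, weight β x * f x)
        + 1 / 2 * ∫ x in (0 : ℝ)..1, weight (-β) x * f x := by
    rw [← intervalIntegral.integral_const_mul, ← intervalIntegral.integral_const_mul,
      ← intervalIntegral.integral_add ((hi _).const_mul _) ((hi _).const_mul _)]
    congr 1; ext x; simp only [weight]; ring
  rw [h2, ← h1]; ring

lemma weight_zero_bounds {x : ℝ} (hx : x ∈ Set.Icc (0 : ℝ) 1) :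
    0.95 ≤ weight 0 x ∧ weight 0 x ≤ 1.09 := by
  obtain ⟨⟨c1, c2⟩, s1, s2⟩ := cosh_sinh_half_bounds
  have h1 := Real.one_le_cosh (x - 1 / 2)
  have h2 : Real.cosh (x - 1 / 2) ≤ Real.cosh (1 / 2) := Real.cosh_le_cosh.2 (by
    rw [abs_of_pos (by norm_num : (0 : ℝ) < 1 / 2), abs_le]
    constructor <;> linarith [hx.1, hx.2])
  rw [weight, zero_mul, add_zero, le_div_iff₀ (by linarith), div_le_iff₀ (by linarith)]
  constructor <;> linarith

/-- The parabola `1 + 2 x (1 - x) / 5` as a trial function at `α = -1`. -/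
lemma le_of_energyGE_neg_one {β t : ℝ} (h : EnergyGE (-1) β t) : t ≤ -1.06 := by
  set u : ℝ → ℝ := fun x => 1 + 0.4 * (x * (1 - x)) with hu
  set g : ℝ → ℝ := fun x => 0.4 * (1 - 2 * x) with hg
  have hH : IsH1 u g := isH1_of_hasDerivAt (fun x _ => by
    refine ((((hasDerivAt_id x).mul ((hasDerivAt_id x).const_sub 1)).const_mul 0.4).const_add
      1).congr_deriv ?_
    simp only [hg, id]; ring) (by fun_prop)
  refine (h u g hH (by simp [hu]) (by simp [hu])).trans ?_
  rw [energy_eq, integral_weight_mul_of_symm (by fun_prop) (fun x => by simp only [hu, hg]; ring)]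
  have hpoly : ∫ x in (0 : ℝ)..1, (1.09 * 0.16 * (1 - 2 * x) ^ 2 - 0.95 * 0.8 * (x * (1 - x)))
      = 1.09 * 0.16 / 3 - 0.95 * 0.8 / 6 := by
    have hd : ∀ x ∈ Set.uIcc (0 : ℝ) 1, HasDerivAt
        (fun x : ℝ => -(1.09 * 0.16 / 6) * (1 - 2 * x) ^ 3
          - 0.95 * 0.8 * (x ^ 2 / 2 - x ^ 3 / 3))
        (1.09 * 0.16 * (1 - 2 * x) ^ 2 - 0.95 * 0.8 * (x * (1 - x))) x := fun x _ => by
      refine ((((((hasDerivAt_id x).const_mul 2).const_sub 1).pow 3).const_mul _).sub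
        ((((hasDerivAt_pow 2 x).div_const 2).sub
          ((hasDerivAt_pow 3 x).div_const 3)).const_mul _)).congr_deriv ?_
      simp only [id]; push_cast; ring
    rw [intervalIntegral.integral_eq_sub_of_hasDerivAt hd
      ((by fun_prop : Continuous _).intervalIntegrable _ _)]
    norm_num
  -- Expanding `u²` with `φ = x (1 - x)`, the term `-0.16 φ²` is dropped, the weight is replaced by
  -- `0.95` or `1.09` according to sign, and its unit mass is kept exactly.
  have hle : ∫ x in (0 : ℝ)..1, weight 0 x * (-1 * u x ^ 2 + g x ^ 2) ≤
      ∫ x in (0 : ℝ)..1, ((1.09 * 0.16 * (1 - 2 * x) ^ 2 - 0.95 * 0.8 * (x * (1 - x)))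
        - weight 0 x) := by
    have hwc := continuous_weight 0
    refine intervalIntegral.integral_mono_on zero_le_one
      ((by fun_prop : Continuous _).intervalIntegrable _ _)
      ((by fun_prop : Continuous _).intervalIntegrable _ _) fun x hx => ?_
    obtain ⟨h1, h2⟩ := weight_zero_bounds hx
    have hφ : 0 ≤ x * (1 - x) := mul_nonneg hx.1 (by linarith [hx.2])
    have h3 := mul_le_mul_of_nonneg_right h2 (sq_nonneg (1 - 2 * x))
    have h4 := mul_le_mul_of_nonneg_right h1 hφ
    have h5 : 0 ≤ weight 0 x * (x * (1 - x)) ^ 2 := by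
      have : 0 ≤ weight 0 x := by linarith
      positivity
    simp only [hu, hg]
    nlinarith
  refine hle.trans ?_
  rw [intervalIntegral.integral_sub ((by fun_prop : Continuous _).intervalIntegrable _ _)
    ((continuous_weight 0).intervalIntegrable _ _), hpoly, integral_weight]
  norm_num

/-- Lower bounds of the energy near `α = -1` depend on `α` in a Lipschitz way. -/
lemma exists_lipschitz_energyGE :
    ∃ C : ℝ, 0 ≤ C ∧ ∀ {δ α α' β t : ℝ}, δ ≤ 1 / 2 → α ∈ Set.Icc (-1 - δ) (-1 + δ) →
      α' ∈ Set.Icc (-1 - δ) (-1 + δ) → -1 ≤ β → β ≤ 1 → EnergyGE α β t →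
      EnergyGE α' β (t - C * δ) := by
  -- Increasing `α` costs nothing because the weight is nonnegative. Decreasing it is interpolation
  -- with the bound at `α = -2`, with parameter `θ ≤ 2δ / (α + 2) ≤ 4δ`.
  refine ⟨4 * |minOne (-2)|, by positivity, ?_⟩
  intro δ α α' β t hδ hα hα' hβ hβ' h
  have hδ0 : 0 ≤ δ := by linarith [hα.1, hα.2]
  have ht := le_of_energyGE h
  rcases le_total α α' with hle | hle
  · refine (h.mono_left (weight_nonneg_of_abs_le_one hβ hβ') hle).mono ?_
    have : 0 ≤ 4 * |minOne (-2)| * δ := by positivity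
    linarith
  · have h2 : EnergyGE (-2) β (minOne (-2)) :=
      energyGE_of_abs_le_one (neg_pi_sq_lt (by norm_num)) hβ hβ'
    have hα2 : 0 < α + 2 := by linarith [hα.1]
    set θ := (α - α') / (α + 2) with hθ
    have hθ0 : 0 ≤ θ := div_nonneg (by linarith) hα2.le
    have hθ1 : θ ≤ 1 := by rw [hθ, div_le_one hα2]; linarith [hα'.1]
    have hθδ : θ ≤ 4 * δ := by
      rw [hθ, div_le_iff₀ hα2]
      nlinarith [hα.1, hα.2, hα'.1]
    have := h.affine_left h2 hθ0 hθ1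
    have e : (1 - θ) * α + θ * -2 = α' := by
      have : θ * (α + 2) = α - α' := div_mul_cancel₀ _ hα2.ne'
      linarith
    rw [e] at this
    refine this.mono ?_
    have h3 : 0 ≤ θ * (minOne (-2) - t + |minOne (-2)|) :=
      mul_nonneg hθ0 (by linarith [neg_abs_le (minOne (-2)), hα.2])
    have h4 := mul_le_mul_of_nonneg_right hθδ (abs_nonneg (minOne (-2)))
    linarith

/-- If `β'` is admissible for some `α` near `-1`, then a slightly larger `β` is admissible for
every `α'` near `-1`. -/
lemma exists_near_admissible {s : ℝ} (hs0 : 0 < s) (hs1 : s ≤ 1) :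
    ∃ δ : ℝ, 0 < δ ∧ δ ≤ 1 / 2 ∧ ∀ α ∈ Set.Icc (-1 - δ) (-1 + δ), ∀ α' ∈ Set.Icc (-1 - δ) (-1 + δ),
      ∀ β' : ℝ, 0 ≤ β' → β' ≤ 1 → EnergyGE α β' (α - β' ^ 2) →
        ∃ β : ℝ, 0 ≤ β ∧ β ≤ β' + s ∧ EnergyGE α' β (α' - β ^ 2) := by
  obtain ⟨C, hC, hlip⟩ := exists_lipschitz_energyGE
  -- All errors from varying `α`, namely `C δ + 2 δ`, amount to one hundredth of `s`, well below the
  -- gain of order `s` found below.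
  set δ := 0.01 * s / (C + 2) with hδ
  have hδ0 : 0 < δ := by positivity
  have hCδ : C * δ + 2 * δ = 0.01 * s := by rw [hδ]; field_simp
  have hCδ0 : 0 ≤ C * δ := by positivity
  have hδ2 : δ ≤ 1 / 2 := by linarith
  refine ⟨δ, hδ0, hδ2, fun α hα α' hα' β' hβ0 hβ1 h => ?_⟩
  have hcenter : (-1 : ℝ) ∈ Set.Icc (-1 - δ) (-1 + δ) := ⟨by linarith, by linarith⟩
  have h1 := le_of_energyGE_neg_one (hlip hδ2 hα hcenter (by linarith) hβ1 h)
  -- The trial bound `-1.06` at `α = -1` forces `β'² ≥ 0.06 - δ - C δ ≥ 0.05`.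
  have hβ2 : 0.2 ≤ β' := by
    have := hα.1
    nlinarith
  have h2 := hlip hδ2 hα hα' (by linarith) hβ1 h
  have h3 := hlip hδ2 hcenter hα' (by norm_num) le_rfl
    ((energyGE_minOne (neg_pi_sq_lt (by norm_num : (-9 : ℝ) ≤ -1 + 1 / 4))).1.mono
      minOne_neg_one_bounds.1.le)
  have h4 := h2.affine_right h3 hs0.le hs1
  refine ⟨(1 - s) * β' + s * 1, ?_, ?_, h4.mono ?_⟩
  · have : 0 ≤ (1 - s) * β' := mul_nonneg (by linarith) hβ0
    linarith
  · nlinarith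
  · have h5 : 0.36 ≤ 2 * β' - β' ^ 2 := by nlinarith
    have h6 := mul_le_mul_of_nonneg_left h5 hs0.le
    have h7 := mul_le_mul_of_nonneg_left hα.1 (by linarith : 0 ≤ 1 - s)
    have h8 := hα'.2
    have h9 : 0 ≤ s ^ 2 * (1 - β') ^ 2 := by positivity
    have h10 : 0 ≤ s * δ := by positivity
    nlinarith

lemma optBeta_le_one {α : ℝ} (hα : α ∈ Set.Icc (-1.5 : ℝ) (-0.5)) : optBeta α ≤ 1 := by
  have hm : α ∈ admissible 1 := by
    obtain ⟨⟨_, h2⟩, h3, _⟩ := alpha_one_bounds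
    rw [admissible_one_eq]
    exact ⟨by linarith [hα.1], by linarith [hα.2]⟩
  simpa using optBeta_le zero_le_one (mem_admissible.1 hm)

/-- The roles of `α` and `α'` are symmetric, so this estimate gives both semicontinuities at `-1`.
Admissible `β' ≥ 1` need no perturbation, as the optimum near `-1` is at most `1`. -/
lemma optBeta_le_add {s : ℝ} (hs0 : 0 < s) (hs1 : s ≤ 1) :
    ∃ δ : ℝ, 0 < δ ∧ ∀ α ∈ Set.Icc (-1 - δ) (-1 + δ), ∀ α' ∈ Set.Icc (-1 - δ) (-1 + δ),
      optBeta α' ≤ optBeta α + ENNReal.ofReal s := by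
  obtain ⟨δ, hδ0, hδ2, h⟩ := exists_near_admissible hs0 hs1
  refine ⟨δ, hδ0, fun α hα α' hα' => ?_⟩
  rw [← tsub_le_iff_right]
  refine le_sInf ?_
  rintro b ⟨β', hβ', rfl⟩
  rw [tsub_le_iff_right]
  rcases le_total (β' : ℝ) 1 with hle | hle
  · obtain ⟨β, hβ0, hβ, hE⟩ := h α hα α' hα' β' β'.coe_nonneg hle (zero_le_gap_iff.1 hβ')
    refine (optBeta_le hβ0 hE).trans ((ENNReal.ofReal_le_ofReal hβ).trans_eq ?_)
    rw [ENNReal.ofReal_add β'.coe_nonneg hs0.le, ENNReal.ofReal_coe_nnreal]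
  · refine (optBeta_le_one ⟨by linarith [hα'.1], by linarith [hα'.2]⟩).trans ?_
    have : (1 : ℝ≥0∞) ≤ β' := by exact_mod_cast hle
    exact this.trans le_self_add

lemma optBeta_neg_one_ne_top : optBeta (-1) ≠ ⊤ :=
  ((optBeta_le_one (by norm_num)).trans_lt ENNReal.one_lt_top).ne

lemma tendsto_optBeta : Tendsto optBeta (𝓝 (-1)) (𝓝 (optBeta (-1))) := by
  rw [ENNReal.tendsto_nhds optBeta_neg_one_ne_top]
  intro ε hε
  obtain ⟨s, hs0, hs⟩ := ENNReal.lt_iff_exists_nnreal_btwn.1 (lt_min hε zero_lt_one)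
  have hs0' : (0 : ℝ) < s := by exact_mod_cast hs0
  have hs1 : (s : ℝ) ≤ 1 := by exact_mod_cast (hs.trans_le (min_le_right _ _)).le
  have hsε : ENNReal.ofReal s ≤ ε := by
    rw [ENNReal.ofReal_coe_nnreal]; exact (hs.trans_le (min_le_left _ _)).le
  obtain ⟨δ, hδ, h⟩ := optBeta_le_add hs0' hs1
  have hcenter : (-1 : ℝ) ∈ Set.Icc (-1 - δ) (-1 + δ) := ⟨by linarith, by linarith⟩
  filter_upwards [Icc_mem_nhds (by linarith : -1 - δ < -1) (by linarith : -1 < -1 + δ)] with α hα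
  exact ⟨tsub_le_iff_right.2 ((h α hα (-1) hcenter).trans (by gcongr)),
    (h (-1) hcenter α hα).trans (by gcongr)⟩

lemma tendsto_alphaOf {l : Filter ℝ} (hl : Tendsto (fun γ : ℝ => γ⁻¹) l (𝓝 0))
    (hne : ∀ᶠ γ in l, γ ≠ 0) : Tendsto alphaOf l (𝓝 (-1)) := by
  have h : Tendsto (fun γ : ℝ => 3 * γ⁻¹ - 1) l (𝓝 (3 * 0 - 1)) := (hl.const_mul 3).sub_const 1
  rw [mul_zero, zero_sub] at h
  refine h.congr' ?_
  filter_upwards [hne] with γ hγ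
  rw [alphaOf_eq hγ, div_eq_mul_inv]

lemma exists_limit_betaGamma : ∃ βinf : ℝ≥0,
    Tendsto betaGamma atTop (𝓝 (βinf : ℝ≥0∞)) ∧ Tendsto betaGamma atBot (𝓝 (βinf : ℝ≥0∞)) ∧
      (βinf : ℝ) ≤ Real.sqrt (-1 - minOne (-1)) := by
  refine ⟨(optBeta (-1)).toNNReal, ?_, ?_, ?_⟩
  · rw [ENNReal.coe_toNNReal optBeta_neg_one_ne_top]
    exact tendsto_optBeta.comp (tendsto_alphaOf tendsto_inv_atTop_zero (eventually_ne_atTop 0))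
  · rw [ENNReal.coe_toNNReal optBeta_neg_one_ne_top]
    exact tendsto_optBeta.comp (tendsto_alphaOf tendsto_inv_atBot_zero (eventually_ne_atBot 0))
  · have hm : (-1 : ℝ) ∈ admissible 1 := by
      obtain ⟨⟨_, h2⟩, h3, _⟩ := alpha_one_bounds
      rw [admissible_one_eq]
      exact ⟨by linarith, by linarith⟩
    exact ENNReal.toReal_le_of_le_ofReal (Real.sqrt_nonneg _)
      (optBeta_le (Real.sqrt_nonneg _) (energyGE_sqrt (by norm_num) hm).2.2)

end

end Rod

theorem theorem2p2 :
    -- the four constants are well defined, with the stated decimal expansions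
    Rod.admissible Rod.kappa = Set.Icc (Rod.alphaMinus Rod.kappa) (Rod.alphaPlus Rod.kappa) ∧
    Rod.admissible 1 = Set.Icc (Rod.alphaMinus 1) (Rod.alphaPlus 1) ∧
    (-1.037 < Rod.gammaOneMinus ∧ Rod.gammaOneMinus ≤ -1.036) ∧
    (0.269 ≤ Rod.gammaOnePlus ∧ Rod.gammaOnePlus < 0.270) ∧
    (-1.509 < Rod.gammaTwoMinus ∧ Rod.gammaTwoMinus ≤ -1.508) ∧
    (0.575 ≤ Rod.gammaTwoPlus ∧ Rod.gammaTwoPlus < 0.576) ∧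
    -- (i), finiteness
    (∀ γ : ℝ, γ ≤ Rod.gammaOneMinus ∨ Rod.gammaOnePlus ≤ γ → Rod.betaGamma γ < ⊤) ∧
    -- (i), the explicit bound; `μ` is any complex square root and the radicand is a real `r ≥ 0`
    (∀ γ : ℝ, γ ≤ Rod.gammaTwoMinus ∨ Rod.gammaTwoPlus ≤ γ →
      ∀ μ : ℂ, (2 * μ) ^ 2 = 1 + 4 * ((3 - (γ : ℂ)) / (γ : ℂ)) →
        ∃ r : ℝ, 0 ≤ r ∧ (r : ℂ) = 3 / (γ : ℂ) - 1 / 2 - Rod.hypTerm μ ∧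
          Rod.betaGamma γ ≤ ENNReal.ofReal (Real.sqrt r)) ∧
    -- (i), the bound through Legendre functions; the coefficients `b`, `c` are real
    (∀ γ : ℝ, (Rod.gammaTwoMinus ≤ γ ∧ γ ≤ Rod.gammaOneMinus) ∨
        (Rod.gammaOnePlus ≤ γ ∧ γ ≤ Rod.gammaTwoPlus) →
      ∀ μ : ℂ, (2 * μ) ^ 2 = 1 + 4 * ((3 - (γ : ℂ)) / (γ : ℂ)) →
        Rod.legendreP (-1 / 2 + μ) (Complex.cosh 1) ≠ 0 ∧
        ∃ b c : ℝ,
          (b : ℂ) = ((Real.exp 1 - 1) / 2 : ℝ) * (Rod.legTerm μ - (-1 / 2 + Rod.hypTerm μ)) ∧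
          (c : ℂ) = ((Real.exp 1 + 1) / 2 : ℝ) * (-1 / 2 + Rod.hypTerm μ)
            - ((Real.exp 1 - 1) / 2 : ℝ) * Rod.legTerm μ - (3 - (γ : ℂ)) / (γ : ℂ) ∧
          0 ≤ b ^ 2 - 4 * c ∧
          Rod.betaGamma γ ≤ ENNReal.ofReal (-b / 2 + 1 / 2 * Real.sqrt (b ^ 2 - 4 * c))) ∧
    -- (ii)
    (∃ βinf : ℝ≥0,
      Tendsto Rod.betaGamma atTop (𝓝 (βinf : ℝ≥0∞)) ∧
      Tendsto Rod.betaGamma atBot (𝓝 (βinf : ℝ≥0∞)) ∧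
      (βinf : ℝ) ≤ Real.sqrt
        (Real.sqrt 3 * (1 - Real.cosh (1 / 2) * Real.cos (Real.sqrt 3 / 2)) /
          (2 * Real.sinh (1 / 2) * Real.sin (Real.sqrt 3 / 2)) - 1 / 2)) ∧
    0.296 ≤ Real.sqrt
        (Real.sqrt 3 * (1 - Real.cosh (1 / 2) * Real.cos (Real.sqrt 3 / 2)) /
          (2 * Real.sinh (1 / 2) * Real.sin (Real.sqrt 3 / 2)) - 1 / 2) ∧
    Real.sqrt
        (Real.sqrt 3 * (1 - Real.cosh (1 / 2) * Real.cos (Real.sqrt 3 / 2)) /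
          (2 * Real.sinh (1 / 2) * Real.sin (Real.sqrt 3 / 2)) - 1 / 2) < 0.297 := by
  refine ⟨Rod.admissible_kappa_eq, Rod.admissible_one_eq, Rod.gammaOneMinus_bounds,
    Rod.gammaOnePlus_bounds, Rod.gammaTwoMinus_bounds, Rod.gammaTwoPlus_bounds,
    fun γ h => Rod.betaGamma_lt_top h, fun γ h μ hμ => Rod.betaGamma_le_sqrt h hμ,
    fun γ h μ hμ => Rod.betaGamma_le_root h hμ, ?_⟩
  rw [Rod.explicit_bound_eq]
  obtain ⟨h1, h2⟩ := Rod.minOne_neg_one_bounds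
  refine ⟨Rod.exists_limit_betaGamma, ?_, ?_⟩
  · refine Real.le_sqrt_of_sq_le ?_
    norm_num
    linarith
  · rw [Real.sqrt_lt' (by norm_num)]
    norm_num
    linarith
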